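/- Let $n\ge 0$ be an integer and $L=2n+1$. For real $J_x,J_y,J_z$, consider the periodic XYZ Hamiltonian $$\mathbf H=-\frac12\sum_{j=1}^{L}\left(J_x\,\sigma^x_j\sigma^x_{j+1}+J_y\,\sigma^y_j\sigma^y_{j+1}+J_z\,\sigma^z_j\sigma^z_{j+1}\right)$$ on $(\mathbb C^2)^{\otimes L}$, where $\sigma^a_j$ is the Pauli matrix $\sigma^a$ acting on the $j$-th tensor factor and the index $L+1$ is read as $1$. For a ground-state vector $\Psi$, i.e. an eigenvector of $\mathbf H$ for its lowest eigenvalue, let $$C^a=\frac{\langle\Psi|\sigma^a_j\sigma^a_{j+1}|\Psi\rangle}{\langle\Psi|\Psi\rangle},\qquad a\in\{x,y,z\}.$$ Then there is a rational function $f_n\in\mathbb R(Z)$, depending only on $n$, such that the following holds for all nonzero real $J_x,J_y,J_z$ satisfying the supersymmetry conditions $J_xJ_y+J_xJ_z+J_yJ_z=0$ and $J_x+J_y+J_z>0$. Let $$Z=\frac{(J_x-J_y)^2(J_y-J_z)^2(J_x-J_z)^2}{J_x^2J_y^2J_z^2}$$ be the normalized discriminant. Then $f_n$ has no pole at $Z$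 and, for every ground-state vector $\Psi$, every $j\in\{1,\dots,L\}$ and every $a\in\{x,y,z\}$, $$C^{a}=1+\frac{J_xJ_yJ_z}{J_a^2\,(J_x+J_y+J_z)}\,f_n(Z).$$ -/

import Mathlib

namespace XYZChain

/-- The three directions labelling the Pauli matrices and the anisotropy parameters. -/
inductive Axis : Type
  | x
  | y
  | z

/-- The Pauli matrices, in the ordered basis (up, down) indexed by `0, 1 : Fin 2`. -/
def pauli : Axis → Matrix (Fin 2) (Fin 2) ℂ
  | .x => !![0, 1; 1, 0]
  | .y => !![0, -Complex.I; Complex.I, 0]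
  | .z => !![1, 0; 0, -1]

/-- Spin configurations on `L` sites; they index the standard basis of `V ^ ⊗ L`,
where `V` is spanned by up (`0`) and down (`1`). -/
abbrev Config (L : ℕ) : Type := Fin L → Fin 2

/-- The state space `V ^ ⊗ L` in coordinates with respect to the standard product basis, with
its standard Hermitian scalar product. -/
abbrev StateSpace (L : ℕ) : Type := EuclideanSpace ℂ (Config L)

/-- The matrix of the operator acting as `A` on the tensor factor `j` and as the identity on all
other tensor factors. -/
def siteMatrix {L : ℕ} (A : Matrix (Fin 2) (Fin 2) ℂ) (j : Fin L) :
    Matrix (Config L) (Config L) ℂ :=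
  Matrix.of fun s t => if ∀ k, k ≠ j → s k = t k then A (s j) (t j) else 0

/-- The operator `σ_j^a σ_{j+1}^a` on the periodic chain of length `2 n + 1`. Addition in
`Fin (2 n + 1)` is cyclic, so the site after the last one is the first one. -/
noncomputable def pairOp (n : ℕ) (a : Axis) (j : Fin (2 * n + 1)) :
    StateSpace (2 * n + 1) →ₗ[ℂ] StateSpace (2 * n + 1) :=
  Matrix.toEuclideanLin (siteMatrix (pauli a) j * siteMatrix (pauli a) (j + 1))

/-- The Hamiltonian of the periodic XYZ spin chain of length `2 n + 1`. -/
noncomputable def hamiltonian (n : ℕ) (J : Axis → ℝ) :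
    StateSpace (2 * n + 1) →ₗ[ℂ] StateSpace (2 * n + 1) :=
  -(1 / 2 : ℂ) • ∑ j : Fin (2 * n + 1),
    ((J .x : ℂ) • pairOp n .x j + (J .y : ℂ) • pairOp n .y j + (J .z : ℂ) • pairOp n .z j)

/-- `Ψ` is a ground-state vector of the chain: a (nonzero) eigenvector of the Hamiltonian for its
lowest eigenvalue. The Hamiltonian is Hermitian, so all its eigenvalues are real. -/
def IsGroundState (n : ℕ) (J : Axis → ℝ) (Ψ : StateSpace (2 * n + 1)) : Prop :=
  ∃ E : ℝ, Module.End.HasEigenvector (hamiltonian n J) (E : ℂ) Ψ ∧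
    ∀ E' : ℝ, Module.End.HasEigenvalue (hamiltonian n J) (E' : ℂ) → E ≤ E'

/-- The expectation value `⟨Ψ|A|Ψ⟩ / ⟨Ψ|Ψ⟩`. -/
noncomputable def expectation {L : ℕ} (Ψ : StateSpace L)
    (A : StateSpace L →ₗ[ℂ] StateSpace L) : ℂ :=
  inner ℂ Ψ (A Ψ) / inner ℂ Ψ Ψ

/-- The normalized discriminant of the anisotropy parameters. -/
noncomputable def normDiscr (J : Axis → ℝ) : ℝ :=
  ((J .x - J .y) ^ 2 * (J .y - J .z) ^ 2 * (J .x - J .z) ^ 2) /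
    (J .x ^ 2 * J .y ^ 2 * J .z ^ 2)

/-- The parameters are supersymmetric. -/
def IsSupersymmetric (J : Axis → ℝ) : Prop :=
  J .x * J .y + J .x * J .z + J .y * J .z = 0 ∧ 0 < J .x + J .y + J .z

end XYZChain

/-! On the supersymmetric cone the couplings are `lam` times $(1+\zeta,\,1-\zeta,\,(\zeta^2-1)/2)$.
After subtracting the expected ground-state energy $-L(J_x+J_y+J_z)/2$, the Hamiltonian becomes
`gapMat`. The proof shows that `gapMat` is positive semidefinite with a two-dimensional kernel, and
then extracts the correlations from that kernel.

Zero energy. On translation-invariant functions, `gapMat` is `lam` times the anticommutator of two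
supercharges. These are signed cyclic sums of the multiplication of $\mathbb R[u]/(u^2-\zeta)$ and
of its transpose (`cycSum_supercharges`), and associativity makes them square to zero. For $\zeta>0$
a Perron–Frobenius argument applies within each spin-flip parity class, so a lowest eigenfunction
orthogonal to a positive weight in both classes vanishes (`IsEigen.eq_zero_of_sum`). Tensor powers
of idempotents and of characters of the algebra give positive weights orthogonal to the images of
the supercharges. Hence both halves of the anticommutator kill a lowest eigenvector, and the lowest
energy is zero (`lowest_eq_zero`). Permuting the axes by tensor powers of Hadamard-type involutions
reaches all nonzero supersymmetric couplings (`IsSupersymmetric.isGapped`).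

Shape of the formula. A zero mode at $J$, used as a trial state at other points of the cone, has
nonnegative energy with minimum zero at $J$. The vanishing value and the vanishing derivative along
the cone are two linear equations for the three numbers $1-C^a$, so only $\sum_a C^a$ stays free
(`correlation_eq`).

Rationality. The kernel projection is, up to a scalar, a polynomial in `gapMat`, so $\sum_a C^a$ is
a quotient of traces polynomial in $J$ (`trace_kerPoly_mul`). Axis permutations make these traces
symmetric. With the second elementary symmetric function zero, a rescaling of $J$ turns the other
two into polynomials in $Z$ (`exists_sum_correlation`). -/

namespace XYZChain

/-! ### Words, cyclic sums and the supercharges -/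

/-- Structure constants of the two-dimensional algebra `ℝ[u] / (u ^ 2 - ζ)` in the basis
`u, ζ · 1`: the coefficient of the basis vector `a` in the product of `b` and `c`. -/
def structConst (ζ : ℝ) (a b c : Fin 2) : ℝ :=
  if a = b + c + 1 then (if b = 0 ∧ c = 0 then 1 else ζ) else 0

/-- Associativity is the cancellation mechanism behind the nilpotency of both supercharges: it pairs
the terms in which one product feeds into the other. -/
theorem structConst_assoc (ζ : ℝ) (a b c d : Fin 2) :
    ∑ x, structConst ζ x b c * structConst ζ a x d =
      ∑ x, structConst ζ x c d * structConst ζ a b x := by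
  fin_cases a <;> fin_cases b <;> fin_cases c <;> fin_cases d <;>
    simp [structConst, Fin.sum_univ_two]

/-- Multiply two letters into the first letter (acting on functions of words). -/
def mergeOp (ζ : ℝ) (ψ : List (Fin 2) → ℝ) : List (Fin 2) → ℝ
  | [] => 0
  | c :: w => ∑ b₁, ∑ b₂, structConst ζ c b₁ b₂ * ψ (b₁ :: b₂ :: w)

/-- The transpose of `mergeOp`. -/
def splitOp (ζ : ℝ) (ψ : List (Fin 2) → ℝ) : List (Fin 2) → ℝ
  | a₁ :: a₂ :: w => ∑ a, structConst ζ a a₁ a₂ * ψ (a :: w)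
  | _ => 0

/-- The sum over all rotations of a word, weighted by powers of `ε`. -/
def cycSum (ε : ℝ) (ψ : List (Fin 2) → ℝ) (w : List (Fin 2)) : ℝ :=
  ∑ k ∈ Finset.range w.length, ε ^ k * ψ (w.rotate k)

/-- `ψ` is multiplied by `ε` under rotations of words of length `N`. -/
def IsCyclic (ε : ℝ) (N : ℕ) (ψ : List (Fin 2) → ℝ) : Prop :=
  ∀ w : List (Fin 2), w.length = N → ψ (w.rotate 1) = ε * ψ w

theorem IsCyclic.rotate {ε : ℝ} {N : ℕ} {ψ : List (Fin 2) → ℝ} (h : IsCyclic ε N ψ)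
    {w : List (Fin 2)} (hw : w.length = N) (k : ℕ) : ψ (w.rotate k) = ε ^ k * ψ w := by
  induction k with
  | zero => simp
  | succ k ih =>
    rw [← List.rotate_rotate, h _ (by simpa using hw), ih]
    ring

theorem IsCyclic.append {ε : ℝ} {N : ℕ} {ψ : List (Fin 2) → ℝ} (h : IsCyclic ε N ψ)
    (u v : List (Fin 2)) (hw : u.length + v.length = N) :
    ψ (v ++ u) = ε ^ u.length * ψ (u ++ v) := by
  rw [← h.rotate (by simpa using hw), List.rotate_append_length_eq]

theorem cycSum_rotate {ε : ℝ} {N : ℕ} (hε : ε * ε = 1) (hN : ε ^ N = 1)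
    (ψ : List (Fin 2) → ℝ) : IsCyclic ε N (cycSum ε ψ) := by
  intro w hw
  have key : ε * cycSum ε ψ (w.rotate 1) = cycSum ε ψ w := by
    unfold cycSum
    rw [List.length_rotate, hw, Finset.mul_sum]
    have h1 := Finset.sum_range_succ (fun k => ε ^ k * ψ (w.rotate k)) N
    rw [Finset.sum_range_succ'] at h1
    have h2 : w.rotate N = w := by rw [← hw, List.rotate_length]
    simp only [pow_zero, List.rotate_zero, hN, h2, add_left_inj] at h1
    rw [← h1]
    refine Finset.sum_congr rfl fun k _ => ?_
    rw [List.rotate_rotate, add_comm 1 k]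
    ring
  rw [← key, ← mul_assoc, hε, one_mul]

/-- A cyclic sum sees its summand only up to rotation and sign, so two local expressions can be
compared after rotating each word to a convenient starting point. -/
theorem cycSum_eq_of_rotate {ε : ℝ} {N : ℕ} (hε : ε * ε = 1) (hN : ε ^ N = 1)
    {X Y : List (Fin 2) → ℝ} (c : ℝ) (j : ℕ)
    (h : ∀ w : List (Fin 2), w.length = N → X w = c * Y (w.rotate j))
    {w : List (Fin 2)} (hw : w.length = N) :
    cycSum ε X w = c * ε ^ j * cycSum ε Y w := by
  rw [mul_assoc, ← (cycSum_rotate hε hN Y).rotate hw]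
  unfold cycSum
  rw [List.length_rotate, Finset.mul_sum]
  refine Finset.sum_congr rfl fun k _ => ?_
  rw [h _ (by simpa using hw), List.rotate_rotate, List.rotate_rotate, add_comm k j]
  ring

theorem cycSum_congr {ε : ℝ} {N : ℕ} {X Y : List (Fin 2) → ℝ}
    (h : ∀ w : List (Fin 2), w.length = N → X w = Y w)
    {w : List (Fin 2)} (hw : w.length = N) : cycSum ε X w = cycSum ε Y w :=
  Finset.sum_congr rfl fun k _ => by rw [h _ (by simpa using hw)]

theorem cycSum_sum {ι : Type*} (ε : ℝ) (s : Finset ι) (c : ι → ℝ)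
    (X : ι → List (Fin 2) → ℝ) (w : List (Fin 2)) :
    cycSum ε (fun v => ∑ i ∈ s, c i * X i v) w = ∑ i ∈ s, c i * cycSum ε (X i) w := by
  unfold cycSum
  simp only [Finset.mul_sum]
  rw [Finset.sum_comm]
  refine Finset.sum_congr rfl fun i _ => Finset.sum_congr rfl fun k _ => ?_
  ring

theorem cycSum_add (ε : ℝ) (X Y : List (Fin 2) → ℝ) (w : List (Fin 2)) :
    cycSum ε (fun v => X v + Y v) w = cycSum ε X w + cycSum ε Y w := by
  simp [cycSum, mul_add, Finset.sum_add_distrib]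

theorem cycSum_smul (ε c : ℝ) (X : List (Fin 2) → ℝ) (w : List (Fin 2)) :
    cycSum ε (fun v => c * X v) w = c * cycSum ε X w := by
  simp only [cycSum, Finset.mul_sum]
  exact Finset.sum_congr rfl fun k _ => by ring

theorem mergeOp_congr (ζ : ℝ) {N : ℕ} {X Y : List (Fin 2) → ℝ}
    (h : ∀ w : List (Fin 2), w.length = N + 1 → X w = Y w)
    {w : List (Fin 2)} (hw : w.length = N) : mergeOp ζ X w = mergeOp ζ Y w := by
  cases w with
  | nil => rfl
  | cons c w =>
    refine Finset.sum_congr rfl fun b₁ _ => Finset.sum_congr rfl fun b₂ _ => ?_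
    rw [h _ (by simpa using hw)]

theorem splitOp_congr (ζ : ℝ) {N : ℕ} {X Y : List (Fin 2) → ℝ}
    (h : ∀ w : List (Fin 2), w.length = N → X w = Y w)
    {w : List (Fin 2)} (hw : w.length = N + 1) : splitOp ζ X w = splitOp ζ Y w := by
  match w with
  | [] => rfl
  | [_] => rfl
  | a₁ :: a₂ :: w =>
    refine Finset.sum_congr rfl fun a _ => ?_
    rw [h _ (by simpa using hw)]

theorem mergeOp_sum {ι : Type*} (ζ : ℝ) (s : Finset ι) (c : ι → ℝ)
    (X : ι → List (Fin 2) → ℝ) (w : List (Fin 2)) :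
    mergeOp ζ (fun v => ∑ i ∈ s, c i * X i v) w = ∑ i ∈ s, c i * mergeOp ζ (X i) w := by
  cases w with
  | nil => simp [mergeOp]
  | cons a w =>
    simp only [mergeOp, Fin.sum_univ_two, Finset.mul_sum, ← Finset.sum_add_distrib]
    exact Finset.sum_congr rfl fun i _ => by ring

theorem splitOp_sum {ι : Type*} (ζ : ℝ) (s : Finset ι) (c : ι → ℝ)
    (X : ι → List (Fin 2) → ℝ) (w : List (Fin 2)) :
    splitOp ζ (fun v => ∑ i ∈ s, c i * X i v) w = ∑ i ∈ s, c i * splitOp ζ (X i) w := by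
  match w with
  | [] => simp [splitOp]
  | [_] => simp [splitOp]
  | a :: b :: w =>
    simp only [splitOp, Fin.sum_univ_two, Finset.mul_sum, ← Finset.sum_add_distrib]
    exact Finset.sum_congr rfl fun i _ => by ring

theorem mergeOp_cycSum (ζ ε : ℝ) {N : ℕ} (X : List (Fin 2) → ℝ) {w : List (Fin 2)}
    (hw : w.length = N) :
    mergeOp ζ (cycSum ε X) w =
      ∑ k ∈ Finset.range (N + 1), ε ^ k * mergeOp ζ (fun v => X (v.rotate k)) w := by
  rw [← mergeOp_sum]
  exact mergeOp_congr ζ (fun v hv => by rw [cycSum, hv]) hw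

theorem splitOp_cycSum (ζ ε : ℝ) {N : ℕ} (X : List (Fin 2) → ℝ) {w : List (Fin 2)}
    (hw : w.length = N + 1) :
    splitOp ζ (cycSum ε X) w =
      ∑ k ∈ Finset.range N, ε ^ k * splitOp ζ (fun v => X (v.rotate k)) w := by
  rw [← splitOp_sum]
  exact splitOp_congr ζ (fun v hv => by rw [cycSum, hv]) hw

theorem rotate_append_of_length {α : Type*} (k : ℕ) (u v : List α) (h : u.length = k) :
    (u ++ v).rotate k = v ++ u := by
  rw [← h, List.rotate_append_length_eq]

theorem exists_split_word {α : Type*} {w : List α} {i N : ℕ} (hw : w.length = N) (hi : i < N) :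
    ∃ (x : List α) (c : α) (y : List α), w = x ++ c :: y ∧ x.length = i ∧
      y.length = N - 1 - i := by
  refine ⟨w.take i, w[i], w.drop (i + 1), ?_, by simp; omega, by simp; omega⟩
  rw [← List.drop_eq_getElem_cons, List.take_append_drop]

theorem exists_split_word_pair {α : Type*} {w : List α} {i N : ℕ} (hw : w.length = N)
    (hi : i + 1 < N) :
    ∃ (x : List α) (c d : α) (y : List α), w = x ++ c :: d :: y ∧ x.length = i ∧
      y.length = N - 2 - i := by
  obtain ⟨x, c, y, rfl, hx, hy⟩ := exists_split_word hw (by omega : i < N)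
  cases y with
  | nil => simp at hy; omega
  | cons d y => exact ⟨x, c, d, y, rfl, hx, by simp at hy; omega⟩

/-- The supercharges square to zero: multiplication. -/
theorem cycSum_mergeOp_cycSum_mergeOp (ζ : ℝ) {N : ℕ} (hN : Even N) {χ : List (Fin 2) → ℝ}
    (hχ : IsCyclic (-1) (N + 2) χ) {w : List (Fin 2)} (hw : w.length = N) :
    cycSum (-1) (mergeOp ζ (cycSum 1 (mergeOp ζ χ))) w = 0 := by
  obtain rfl | hN0 := Nat.eq_zero_or_pos N
  · simp [cycSum, hw]
  obtain ⟨K, rfl⟩ : ∃ K, N = K + 1 := ⟨N - 1, by omega⟩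
  set Y : ℕ → List (Fin 2) → ℝ := fun k => mergeOp ζ (fun v => mergeOp ζ χ (v.rotate (k + 2)))
    with hY
  have h1 : ∀ v : List (Fin 2), v.length = K + 1 →
      mergeOp ζ (cycSum 1 (mergeOp ζ χ)) v = ∑ k ∈ Finset.range K, 1 * Y k v := by
    intro v hv
    rw [mergeOp_cycSum ζ 1 _ hv, Finset.sum_range_succ', Finset.sum_range_succ', add_assoc]
    -- In these two terms one product feeds into the other. They are the two bracketings of a triple
    -- product, with opposite signs from the cyclicity of `χ`.
    have hz : mergeOp ζ (fun v => mergeOp ζ χ (v.rotate (0 + 1))) v +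
        mergeOp ζ (fun v => mergeOp ζ χ (v.rotate 0)) v = 0 := by
      match v, hv with
      | c :: v, hv =>
        have hc : ∀ b₁ b₃ b₄ : Fin 2, χ (b₃ :: b₄ :: (v ++ [b₁])) =
            -χ (b₁ :: b₃ :: b₄ :: v) := by
          intro b₁ b₃ b₄
          have := hχ.append [b₁] (b₃ :: b₄ :: v) (by simp at hv ⊢; omega)
          simpa using this
        have e1 := structConst_assoc ζ c 0 0 0
        have e2 := structConst_assoc ζ c 0 0 1
        have e3 := structConst_assoc ζ c 0 1 0
        have e4 := structConst_assoc ζ c 0 1 1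
        have e5 := structConst_assoc ζ c 1 0 0
        have e6 := structConst_assoc ζ c 1 0 1
        have e7 := structConst_assoc ζ c 1 1 0
        have e8 := structConst_assoc ζ c 1 1 1
        simp only [Fin.sum_univ_two] at e1 e2 e3 e4 e5 e6 e7 e8
        simp only [mergeOp, List.rotate_cons_succ, List.rotate_zero, List.cons_append, hc,
          Fin.sum_univ_two]
        linear_combination χ (0 :: 0 :: 0 :: v) * e1 + χ (0 :: 0 :: 1 :: v) * e2 +
          χ (0 :: 1 :: 0 :: v) * e3 + χ (0 :: 1 :: 1 :: v) * e4 + χ (1 :: 0 :: 0 :: v) * e5 +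
          χ (1 :: 0 :: 1 :: v) * e6 + χ (1 :: 1 :: 0 :: v) * e7 + χ (1 :: 1 :: 1 :: v) * e8
    simp only [one_pow, one_mul] at hz ⊢
    rw [hz, add_zero]
  rw [cycSum_congr h1 hw, cycSum_sum]
  simp only [one_mul]
  -- The remaining terms merge two disjoint pairs. Exchanging the two merges reflects `k` to `K - 1
  -- - k` and costs the sign $(-1)^K=-1$, so the sum equals its own negative.
  have h2 : ∀ k ∈ Finset.range K, cycSum (-1) (Y k) w = -cycSum (-1) (Y (K - 1 - k)) w := by
    intro k hk
    rw [Finset.mem_range] at hk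
    rw [cycSum_eq_of_rotate (by norm_num) hN.neg_one_pow ((-1) ^ (K - 1 - k)) (k + 1) ?_ hw
      (Y := Y (K - 1 - k)), ← pow_add]
    · have : Odd (K - 1 - k + (k + 1)) := by
        rw [show K - 1 - k + (k + 1) = K by omega]
        exact (Nat.even_add_one.mp hN) |> Nat.not_even_iff_odd.mp
      rw [this.neg_one_pow, neg_one_mul]
    · intro v hv
      match v, hv with
      | c :: v, hv =>
        obtain ⟨x, a, y, rfl, hx, hy⟩ := exists_split_word (by simpa using hv) hk
        have r1 : (c :: (x ++ a :: y)).rotate (k + 1) = a :: (y ++ c :: x) := by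
          simpa using rotate_append_of_length (k + 1) (c :: x) (a :: y) (by simp [hx])
        have r2 : ∀ b₁ b₂ : Fin 2, (b₁ :: b₂ :: (x ++ a :: y)).rotate (k + 2) =
            a :: (y ++ b₁ :: b₂ :: x) := fun b₁ b₂ => by
          simpa using rotate_append_of_length (k + 2) (b₁ :: b₂ :: x) (a :: y) (by simp [hx])
        have r3 : ∀ b₁ b₂ : Fin 2, (b₁ :: b₂ :: (y ++ c :: x)).rotate (K - 1 - k + 2) =
            c :: (x ++ b₁ :: b₂ :: y) := fun b₁ b₂ => by
          simpa using rotate_append_of_length (K - 1 - k + 2) (b₁ :: b₂ :: y) (c :: x) (by simp [hy])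
        have hc : ∀ a₁ a₂ b₁ b₂ : Fin 2, χ (a₁ :: a₂ :: (y ++ b₁ :: b₂ :: x)) =
            (-1) ^ (K - 1 - k) * χ (b₁ :: b₂ :: (x ++ a₁ :: a₂ :: y)) := by
          intro a₁ a₂ b₁ b₂
          have := hχ.append (a₁ :: a₂ :: y) (b₁ :: b₂ :: x) (by simp at hv ⊢; omega)
          simp only [List.cons_append, List.length_cons, hy] at this
          rw [this, ← mul_assoc, ← pow_add]
          have h : Even (K - 1 - k + (K - 1 - k + 1 + 1)) := ⟨K - 1 - k + 1, by omega⟩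
          rw [h.neg_one_pow, one_mul]
        rw [r1]
        simp only [hY, mergeOp, r2, r3, hc, Fin.sum_univ_two]
        ring
  have h3 := Finset.sum_congr rfl h2
  rw [Finset.sum_neg_distrib, Finset.sum_range_reflect (fun k => cycSum (-1) (Y k) w)] at h3
  linarith

/-- The supercharges square to zero: comultiplication. -/
theorem cycSum_splitOp_cycSum_splitOp (ζ : ℝ) {N : ℕ} (hN : Even N) {χ : List (Fin 2) → ℝ}
    (hχ : IsCyclic (-1) N χ) {w : List (Fin 2)} (hw : w.length = N + 2) :
    cycSum (-1) (splitOp ζ (cycSum 1 (splitOp ζ χ))) w = 0 := by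
  have hN2 : Even (N + 2) := by rw [Nat.even_add]; simp [hN]
  set Y : ℕ → List (Fin 2) → ℝ := fun k => splitOp ζ (fun v => splitOp ζ χ (v.rotate k))
    with hY
  have h1 : ∀ v : List (Fin 2), v.length = N + 2 →
      splitOp ζ (cycSum 1 (splitOp ζ χ)) v = ∑ k ∈ Finset.range (N + 1), 1 * Y k v := by
    intro v hv
    rw [splitOp_cycSum ζ 1 _ hv]
    simp [hY]
  rw [cycSum_congr h1 hw, cycSum_sum]
  simp only [one_mul]
  obtain rfl | hN0 := Nat.eq_zero_or_pos N
  · simp only [zero_add, Finset.range_one, Finset.sum_singleton]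
    have : ∀ v : List (Fin 2), v.length = 0 + 2 → Y 0 v = 0 := by
      intro v hv
      match v, hv with
      | [a, b], _ => simp [hY, splitOp]
    rw [cycSum_congr (Y := fun _ => 0) this hw]
    simp [cycSum]
  obtain ⟨K, rfl⟩ : ∃ K, N = K + 1 := ⟨N - 1, by omega⟩
  have hK : Odd K := (Nat.even_add_one.mp hN) |> Nat.not_even_iff_odd.mp
  -- The two nested terms, where the second splitting acts on a letter produced by the first: they
  -- cancel by associativity after one rotation.
  have h0 : cycSum (-1) (Y 0) w = -cycSum (-1) (Y (K + 1)) w := by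
    rw [cycSum_eq_of_rotate (by norm_num) hN2.neg_one_pow 1 1 ?_ hw (Y := Y (K + 1))]
    · ring
    intro v hv
    match v, hv with
    | b :: a₁ :: a₂ :: v, hv =>
      have r1 : ∀ a : Fin 2, (a :: (v ++ [b])).rotate (K + 1) = b :: a :: v := fun a => by
        simpa using rotate_append_of_length (K + 1) (a :: v) [b] (by simp at hv ⊢; omega)
      have e := structConst_assoc ζ
      simp only [Fin.sum_univ_two] at e
      simp only [hY, splitOp, List.rotate_zero, List.rotate_cons_succ, List.cons_append, r1,
        Fin.sum_univ_two]
      linear_combination χ (0 :: v) * e 0 b a₁ a₂ + χ (1 :: v) * e 1 b a₁ a₂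
  have h2 : ∀ k ∈ Finset.range K, cycSum (-1) (Y (k + 1)) w =
      -cycSum (-1) (Y (K - 1 - k + 1)) w := by
    intro k hk
    rw [Finset.mem_range] at hk
    rw [cycSum_eq_of_rotate (by norm_num) hN2.neg_one_pow ((-1) ^ (K - 1 - k + 1)) (k + 2) ?_ hw
      (Y := Y (K - 1 - k + 1)), ← pow_add]
    · have : Odd (K - 1 - k + 1 + (k + 2)) := by
        rw [show K - 1 - k + 1 + (k + 2) = K + 2 by omega]
        exact hK.add_even even_two
      rw [this.neg_one_pow, neg_one_mul]
    · intro v hv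
      match v, hv with
      | a₁ :: a₂ :: v, hv =>
        obtain ⟨x, b₁, b₂, y, rfl, hx, hy⟩ :=
          exists_split_word_pair (i := k) (N := K + 1) (by simpa using hv) (by omega)
        have r1 : (a₁ :: a₂ :: (x ++ b₁ :: b₂ :: y)).rotate (k + 2) =
            b₁ :: b₂ :: (y ++ a₁ :: a₂ :: x) := by
          simpa using rotate_append_of_length (k + 2) (a₁ :: a₂ :: x) (b₁ :: b₂ :: y) (by simp [hx])
        have r2 : ∀ a : Fin 2, (a :: (x ++ b₁ :: b₂ :: y)).rotate (k + 1) =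
            b₁ :: b₂ :: (y ++ a :: x) := fun a => by
          simpa using rotate_append_of_length (k + 1) (a :: x) (b₁ :: b₂ :: y) (by simp [hx])
        have r3 : ∀ b : Fin 2, (b :: (y ++ a₁ :: a₂ :: x)).rotate (K - 1 - k + 1) =
            a₁ :: a₂ :: (x ++ b :: y) := fun b => by
          simpa using rotate_append_of_length (K - 1 - k + 1) (b :: y) (a₁ :: a₂ :: x) (by simp [hy])
        have hc : ∀ a b : Fin 2, χ (b :: (y ++ a :: x)) =
            (-1) ^ (K - 1 - k + 1) * χ (a :: (x ++ b :: y)) := by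
          intro a b
          have := hχ.append (b :: y) (a :: x) (by simp at hv ⊢; omega)
          simp only [List.cons_append, List.length_cons, hy] at this
          rw [this, ← mul_assoc, ← pow_add]
          have h : Even (K - 1 - k + 1 + (K + 1 - 2 - k + 1)) := ⟨K - 1 - k + 1, by omega⟩
          rw [h.neg_one_pow, one_mul]
        rw [r1]
        simp only [hY, splitOp, r2, r3, hc, Fin.sum_univ_two]
        ring
  rw [Finset.sum_range_succ', Finset.sum_range_succ, h0]
  have h3 := Finset.sum_congr rfl h2
  rw [Finset.sum_neg_distrib,
    Finset.sum_range_reflect (fun k => cycSum (-1) (Y (k + 1)) w)] at h3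
  linarith

/-- The local Hamiltonian density of the supersymmetric chain acting on the first two letters. -/
noncomputable def localOp (ζ : ℝ) (ψ : List (Fin 2) → ℝ) : List (Fin 2) → ℝ
  | a :: b :: w =>
    if a = b then ψ (a :: b :: w) - ζ * ψ ((a + 1) :: (b + 1) :: w)
    else (1 + ζ ^ 2) / 2 * ψ (a :: b :: w) - ψ ((a + 1) :: (b + 1) :: w)
  | _ => 0

/-- A merge and a split acting on disjoint letters commute, so the two orders differ only by where
the word is cut open. The rotation amounts locate the other operation within the word. -/
theorem cycSum_splitOp_mergeOp_eq (ζ : ℝ) {N i : ℕ} (hi : i < N) {ψ : List (Fin 2) → ℝ}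
    (hψ : IsCyclic 1 (N + 2) ψ) {w : List (Fin 2)} (hw : w.length = N + 2) :
    cycSum 1 (splitOp ζ (fun v => mergeOp ζ ψ (v.rotate (i + 1)))) w =
      cycSum 1 (mergeOp ζ (fun v => splitOp ζ ψ (v.rotate (N - 1 - i + 2)))) w := by
  rw [cycSum_eq_of_rotate (by norm_num) (one_pow _) 1 (i + 2) ?_ hw
    (Y := mergeOp ζ (fun v => splitOp ζ ψ (v.rotate (N - 1 - i + 2))))]
  · simp
  intro v hv
  match v, hv with
  | a₁ :: a₂ :: v, hv =>
    obtain ⟨y, c, x, rfl, hy, hx⟩ := exists_split_word (by simpa using hv) hi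
    have r1 : (a₁ :: a₂ :: (y ++ c :: x)).rotate (i + 2) = c :: (x ++ a₁ :: a₂ :: y) := by
      simpa using rotate_append_of_length (i + 2) (a₁ :: a₂ :: y) (c :: x) (by simp [hy])
    have r2 : ∀ a : Fin 2, (a :: (y ++ c :: x)).rotate (i + 1) = c :: (x ++ a :: y) := fun a => by
      simpa using rotate_append_of_length (i + 1) (a :: y) (c :: x) (by simp [hy])
    have r3 : ∀ b₁ b₂ : Fin 2, (b₁ :: b₂ :: (x ++ a₁ :: a₂ :: y)).rotate (N - 1 - i + 2) =
        a₁ :: a₂ :: (y ++ b₁ :: b₂ :: x) := fun b₁ b₂ => by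
      simpa using rotate_append_of_length (N - 1 - i + 2) (b₁ :: b₂ :: x) (a₁ :: a₂ :: y)
        (by simp [hx])
    have hc : ∀ a b₁ b₂ : Fin 2, ψ (b₁ :: b₂ :: (x ++ a :: y)) =
        ψ (a :: (y ++ b₁ :: b₂ :: x)) := fun a b₁ b₂ => by
      simpa using hψ.append (a :: y) (b₁ :: b₂ :: x) (by simp at hv ⊢; omega)
    rw [r1]
    simp only [mergeOp, splitOp, r2, r3, hc, Fin.sum_univ_two]
    ring

/-- On rotation-invariant functions the Hamiltonian is the anticommutator of the supercharges. -/
theorem cycSum_supercharges (ζ : ℝ) {N : ℕ} (hN : Odd N) {ψ : List (Fin 2) → ℝ}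
    (hψ : IsCyclic 1 (N + 2) ψ) {w : List (Fin 2)} (hw : w.length = N + 2) :
    cycSum 1 (splitOp ζ (cycSum (-1) (mergeOp ζ ψ))) w +
      cycSum 1 (mergeOp ζ (cycSum (-1) (splitOp ζ ψ))) w = cycSum 1 (localOp ζ ψ) w := by
  set P : ℕ → List (Fin 2) → ℝ := fun k => splitOp ζ (fun v => mergeOp ζ ψ (v.rotate k)) with hP
  set Q : ℕ → List (Fin 2) → ℝ := fun k => mergeOp ζ (fun v => splitOp ζ ψ (v.rotate k)) with hQ
  have h1 : cycSum 1 (splitOp ζ (cycSum (-1) (mergeOp ζ ψ))) w =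
      ∑ k ∈ Finset.range (N + 1), (-1) ^ k * cycSum 1 (P k) w := by
    rw [← cycSum_sum]
    exact cycSum_congr (fun v hv => splitOp_cycSum ζ (-1) _ hv) hw
  have h2 : cycSum 1 (mergeOp ζ (cycSum (-1) (splitOp ζ ψ))) w =
      ∑ k ∈ Finset.range (N + 3), (-1) ^ k * cycSum 1 (Q k) w := by
    rw [← cycSum_sum]
    exact cycSum_congr (fun v hv => mergeOp_cycSum ζ (-1) _ hv) hw
  -- Since `N` is odd, disjoint merge-split pairs enter the two products of supercharges with
  -- opposite signs and disappear; only overlapping ones remain.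
  have h3 : ∑ i ∈ Finset.range N, (-1 : ℝ) ^ (i + 1) * cycSum 1 (P (i + 1)) w =
      -∑ i ∈ Finset.range N, (-1 : ℝ) ^ (i + 1 + 1) * cycSum 1 (Q (i + 1 + 1)) w := by
    rw [← Finset.sum_range_reflect (fun i => (-1 : ℝ) ^ (i + 1 + 1) * cycSum 1 (Q (i + 1 + 1)) w),
      ← Finset.sum_neg_distrib]
    refine Finset.sum_congr rfl fun i hi => ?_
    rw [Finset.mem_range] at hi
    have e : (-1 : ℝ) ^ (N - 1 - i + 1 + 1) = (-1) ^ i := by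
      rw [neg_one_pow_eq_pow_mod_two, neg_one_pow_eq_pow_mod_two (n := i)]
      congr 1
      obtain ⟨m, rfl⟩ := hN
      omega
    rw [show cycSum 1 (P (i + 1)) w = cycSum 1 (Q (N - 1 - i + 1 + 1)) w from
      cycSum_splitOp_mergeOp_eq ζ hi hψ hw, e]
    ring
  have h4 : ∀ X : List (Fin 2) → ℝ, cycSum 1 (fun v => X (v.rotate 1)) w = cycSum 1 X w := by
    intro X
    rw [cycSum_eq_of_rotate (by norm_num) (one_pow _) 1 1 (fun v _ => by rw [one_mul]) hw]
    simp
  -- The four overlapping terms add up to the two-site density. `Q 0` acts on a single letter and is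
  -- shared equally between the two sites; rotation by `N + 2` is rotation by $-1$ on words of
  -- length `N + 3`.
  have h5 : ∀ v : List (Fin 2), v.length = N + 2 → localOp ζ ψ v =
      ((((P 0 v) + 1 / 2 * Q 0 v) + 1 / 2 * Q 0 (v.rotate 1)) + (-1) * Q 1 v) +
        (-1) * Q (N + 2) (v.rotate 1) := by
    intro v hv
    match v, hv with
    | a :: c :: v, hv =>
      have hc : ∀ b c : Fin 2, ψ (b :: (v ++ [c])) = ψ (c :: b :: v) := fun b c => by
        simpa using hψ.append [c] (b :: v) (by simp at hv ⊢; omega)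
      have r : ∀ b₁ b₂ : Fin 2, (b₁ :: b₂ :: (v ++ [a])).rotate (N + 2) =
          a :: b₁ :: b₂ :: v := fun b₁ b₂ => by
        simpa using rotate_append_of_length (N + 2) (b₁ :: b₂ :: v) [a] (by simpa using hv)
      simp only [hP, hQ, mergeOp, splitOp, localOp, List.rotate_cons_succ, List.rotate_zero,
        List.cons_append, hc, r, Fin.sum_univ_two]
      fin_cases a <;> fin_cases c <;> simp [structConst] <;> ring
  have h6 : cycSum 1 (localOp ζ ψ) w = cycSum 1 (P 0) w + cycSum 1 (Q 0) w - cycSum 1 (Q 1) w -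
      cycSum 1 (Q (N + 2)) w := by
    rw [cycSum_congr h5 hw, cycSum_add, cycSum_add, cycSum_add, cycSum_add, cycSum_smul,
      cycSum_smul, cycSum_smul, cycSum_smul, h4, h4]
    ring
  rw [h1, h2, h6, Finset.sum_range_succ', Finset.sum_range_succ, Finset.sum_range_succ',
    Finset.sum_range_succ', h3]
  have e : (-1 : ℝ) ^ (N + 2) = -1 := (hN.add_even even_two).neg_one_pow
  rw [e]
  simp only [zero_add, pow_zero, pow_one]
  ring

/-! ### Positive functionals killed by the supercharges -/

/-- Pairing of a function on words of length `N` with the `N`-th tensor power of `e`. -/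
def wordSum (e : Fin 2 → ℝ) : ℕ → (List (Fin 2) → ℝ) → ℝ
  | 0, ψ => ψ []
  | N + 1, ψ => ∑ a, e a * wordSum e N (fun w => ψ (a :: w))

theorem wordSum_congr (e : Fin 2 → ℝ) {N : ℕ} {X Y : List (Fin 2) → ℝ}
    (h : ∀ w : List (Fin 2), w.length = N → X w = Y w) : wordSum e N X = wordSum e N Y := by
  induction N generalizing X Y with
  | zero => exact h [] rfl
  | succ N ih =>
    exact Finset.sum_congr rfl fun a _ => by rw [ih fun w hw => h (a :: w) (by simp [hw])]

theorem wordSum_sum {ι : Type*} (e : Fin 2 → ℝ) (N : ℕ) (s : Finset ι) (c : ι → ℝ)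
    (X : ι → List (Fin 2) → ℝ) :
    wordSum e N (fun w => ∑ i ∈ s, c i * X i w) = ∑ i ∈ s, c i * wordSum e N (X i) := by
  induction N generalizing X with
  | zero => rfl
  | succ N ih =>
    simp only [wordSum, ih, Fin.sum_univ_two, Finset.mul_sum, ← Finset.sum_add_distrib]
    exact Finset.sum_congr rfl fun i _ => by ring

theorem wordSum_succ_append (e : Fin 2 → ℝ) (N : ℕ) (ψ : List (Fin 2) → ℝ) :
    wordSum e (N + 1) ψ = ∑ a, e a * wordSum e N (fun w => ψ (w ++ [a])) := by
  induction N generalizing ψ with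
  | zero => rfl
  | succ N ih =>
    have h : ∀ b, wordSum e (N + 1) (fun w => ψ (b :: w)) =
        ∑ a, e a * wordSum e N (fun w => ψ (b :: (w ++ [a]))) := fun b => ih _
    rw [wordSum]
    simp only [h]
    simp only [wordSum, Fin.sum_univ_two, List.cons_append]
    ring

theorem wordSum_rotate (e : Fin 2 → ℝ) (N k : ℕ) (ψ : List (Fin 2) → ℝ) :
    wordSum e N (fun w => ψ (w.rotate k)) = wordSum e N ψ := by
  induction k generalizing ψ with
  | zero => simp
  | succ k ih =>
    cases N with
    | zero => simp [wordSum]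
    | succ N =>
      rw [← ih ψ, wordSum_succ_append e N fun w => ψ (w.rotate k)]
      simp [wordSum]

theorem wordSum_cycSum (e : Fin 2 → ℝ) (ε : ℝ) (N : ℕ) (ψ : List (Fin 2) → ℝ) :
    wordSum e N (cycSum ε ψ) = (∑ k ∈ Finset.range N, ε ^ k) * wordSum e N ψ := by
  rw [wordSum_congr e (Y := fun w => ∑ k ∈ Finset.range N, ε ^ k * ψ (w.rotate k))
    (fun w hw => by rw [cycSum, hw]), wordSum_sum, Finset.sum_mul]
  exact Finset.sum_congr rfl fun k _ => by rw [wordSum_rotate]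

/-- The hypothesis says that `e`, read as an element of the algebra, is idempotent. -/
theorem wordSum_splitOp {ζ : ℝ} {e : Fin 2 → ℝ}
    (he : ∀ a, ∑ b, ∑ c, e b * e c * structConst ζ a b c = e a) (N : ℕ)
    (ψ : List (Fin 2) → ℝ) : wordSum e (N + 2) (splitOp ζ ψ) = wordSum e (N + 1) ψ := by
  simp only [wordSum, splitOp, wordSum_sum]
  have h0 := he 0
  have h1 := he 1
  simp only [Fin.sum_univ_two] at h0 h1 ⊢
  linear_combination wordSum e N (fun w => ψ (0 :: w)) * h0 +
    wordSum e N (fun w => ψ (1 :: w)) * h1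

/-- The hypothesis says that `e`, read as a linear functional on the algebra, is multiplicative. -/
theorem wordSum_mergeOp {ζ : ℝ} {e : Fin 2 → ℝ}
    (he : ∀ b c, ∑ a, e a * structConst ζ a b c = e b * e c) (N : ℕ)
    (ψ : List (Fin 2) → ℝ) : wordSum e (N + 1) (mergeOp ζ ψ) = wordSum e (N + 2) ψ := by
  have h : ∀ a, wordSum e N (fun w => mergeOp ζ ψ (a :: w)) =
      ∑ b, ∑ c, structConst ζ a b c * wordSum e N (fun w => ψ (b :: c :: w)) := by
    intro a
    have h1 := wordSum_sum e N Finset.univ (fun _ : Fin 2 => (1 : ℝ))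
      (fun b w => ∑ c, structConst ζ a b c * ψ (b :: c :: w))
    simp only [one_mul, wordSum_sum] at h1
    exact h1
  simp only [wordSum, h]
  have h00 := he 0 0
  have h01 := he 0 1
  have h10 := he 1 0
  have h11 := he 1 1
  simp only [Fin.sum_univ_two] at h00 h01 h10 h11 ⊢
  linear_combination wordSum e N (fun w => ψ (0 :: 0 :: w)) * h00 +
    wordSum e N (fun w => ψ (0 :: 1 :: w)) * h01 + wordSum e N (fun w => ψ (1 :: 0 :: w)) * h10 +
    wordSum e N (fun w => ψ (1 :: 1 :: w)) * h11

theorem wordSum_eq_sum (e : Fin 2 → ℝ) (N : ℕ) (ψ : List (Fin 2) → ℝ) :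
    wordSum e N ψ = ∑ s : Fin N → Fin 2, (∏ i, e (s i)) * ψ (List.ofFn s) := by
  induction N generalizing ψ with
  | zero => simp [wordSum]
  | succ N ih =>
    rw [← (Fin.consEquiv fun _ : Fin (N + 1) => Fin 2).sum_comp, Fintype.sum_prod_type]
    simp only [wordSum, ih, Finset.mul_sum]
    refine Finset.sum_congr rfl fun a _ => Finset.sum_congr rfl fun s _ => ?_
    simp [Fin.consEquiv, Fin.prod_univ_succ, List.ofFn_succ, mul_assoc]

theorem wordSum_smul (c : ℝ) (e : Fin 2 → ℝ) (N : ℕ) (ψ : List (Fin 2) → ℝ) :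
    wordSum (fun a => c * e a) N ψ = c ^ N * wordSum e N ψ := by
  induction N generalizing ψ with
  | zero => simp [wordSum]
  | succ N ih =>
    simp only [wordSum, ih, Finset.mul_sum]
    exact Finset.sum_congr rfl fun a _ => by ring

/-- The pairing with the tensor power of an idempotent annihilates the image of comultiplication. -/
theorem wordSum_supercharge_split {ζ r : ℝ} (hr : r ≠ 0) (hζ : r ^ 2 = ζ) {N : ℕ} (hN : Odd N)
    (ψ : List (Fin 2) → ℝ) :
    wordSum ![r, 1] (N + 2) (cycSum 1 (splitOp ζ (cycSum (-1) ψ))) = 0 := by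
  -- This is the idempotent $(1+u/r)/2$ in the basis $u,\ \zeta\cdot1$. The pairing vanishes because
  -- the inner alternating cyclic sum runs over words of even length `N + 1`.
  set e : Fin 2 → ℝ := fun a => 1 / (2 * r ^ 2) * ![r, 1] a with he
  have h : wordSum e (N + 2) (cycSum 1 (splitOp ζ (cycSum (-1) ψ))) = 0 := by
    rw [wordSum_cycSum, wordSum_splitOp, wordSum_cycSum, neg_one_geom_sum,
      if_pos (Nat.even_add_one.mpr (Nat.not_even_iff_odd.mpr hN))]
    · ring
    · intro a
      subst hζ
      fin_cases a <;> simp [he, Fin.sum_univ_two, structConst] <;> field_simp <;> ring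
  rw [he, wordSum_smul] at h
  exact (mul_eq_zero.mp h).resolve_left (by positivity)

/-- The pairing with the tensor power of a character annihilates the image of multiplication. -/
theorem wordSum_supercharge_merge {ζ r : ℝ} (hr : r ≠ 0) (hζ : r ^ 2 = ζ) {N : ℕ} (hN : Odd N)
    (ψ : List (Fin 2) → ℝ) :
    wordSum ![1, r] (N + 2) (cycSum 1 (mergeOp ζ (cycSum (-1) ψ))) = 0 := by
  -- The values on $u$ and $\zeta\cdot1$ of the character sending $u$ to $r$; here the alternating
  -- sum has the even length `N + 3`.
  set e : Fin 2 → ℝ := fun a => r * ![1, r] a with he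
  have h : wordSum e (N + 2) (cycSum 1 (mergeOp ζ (cycSum (-1) ψ))) = 0 := by
    rw [wordSum_cycSum, wordSum_mergeOp, wordSum_cycSum, neg_one_geom_sum,
      if_pos (by obtain ⟨m, rfl⟩ := hN; exact ⟨m + 2, by ring⟩)]
    · ring
    · intro b c
      subst hζ
      fin_cases b <;> fin_cases c <;> simp [he, structConst] <;> ring_nf <;> simp
  rw [he, wordSum_smul] at h
  exact (mul_eq_zero.mp h).resolve_left (pow_ne_zero _ hr)

/-- On rotation-invariant eigenfunctions of the Hamiltonian, `splitOp` after `mergeOp` produces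
eigenfunctions for the same eigenvalue. -/
theorem cycSum_localOp_supercharge (ζ E : ℝ) {N : ℕ} (hN : Odd N) {ψ : List (Fin 2) → ℝ}
    (hψ : IsCyclic 1 (N + 2) ψ)
    (hE : ∀ w : List (Fin 2), w.length = N + 2 → cycSum 1 (localOp ζ ψ) w = E * ψ w)
    {w : List (Fin 2)} (hw : w.length = N + 2) :
    cycSum 1 (localOp ζ (cycSum 1 (splitOp ζ (cycSum (-1) (mergeOp ζ ψ))))) w =
      E * cycSum 1 (splitOp ζ (cycSum (-1) (mergeOp ζ ψ))) w := by
  have hN1 : Even (N + 1) := Nat.even_add_one.mpr (Nat.not_even_iff_odd.mpr hN)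
  have hN3 : Even (N + 3) := by obtain ⟨m, rfl⟩ := hN; exact ⟨m + 2, by ring⟩
  set ψ₁ := cycSum 1 (splitOp ζ (cycSum (-1) (mergeOp ζ ψ))) with hψ₁
  set ψ₂ := cycSum 1 (mergeOp ζ (cycSum (-1) (splitOp ζ ψ))) with hψ₂
  have hc₁ : IsCyclic 1 (N + 2) ψ₁ := cycSum_rotate (by norm_num) (one_pow _) _
  -- With $S,M$ the two halves of the anticommutator, nilpotency gives $MS=SM=0$. Hence
  -- $(S+M)\psi_1=S\psi_1=S(E\psi-\psi_2)=E\psi_1$.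
  have hsplit : ∀ v : List (Fin 2), v.length = N + 3 → cycSum (-1) (splitOp ζ ψ₁) v = 0 :=
    fun v hv => cycSum_splitOp_cycSum_splitOp ζ hN1
      (cycSum_rotate (by norm_num) hN1.neg_one_pow _) hv
  have hmerge : ∀ v : List (Fin 2), v.length = N + 1 → cycSum (-1) (mergeOp ζ ψ₂) v = 0 :=
    fun v hv => cycSum_mergeOp_cycSum_mergeOp ζ hN1
      (cycSum_rotate (by norm_num) hN3.neg_one_pow _) hv
  have hzero : ∀ v : List (Fin 2), v.length = N + 2 →
      mergeOp ζ (cycSum (-1) (splitOp ζ ψ₁)) v = 0 := fun v hv => by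
    rw [mergeOp_congr ζ hsplit hv]
    cases v <;> simp [mergeOp]
  have h1 := cycSum_supercharges ζ hN hc₁ hw
  rw [cycSum_congr hzero hw, show cycSum 1 (fun _ => 0) w = 0 by simp [cycSum], add_zero] at h1
  rw [← h1, hψ₁, ← cycSum_smul]
  refine cycSum_congr (fun v hv => ?_) hw
  have hlin : ∀ v : List (Fin 2), v.length = N + 1 →
      cycSum (-1) (mergeOp ζ ψ₁) v =
        ∑ i ∈ Finset.range 1, E * cycSum (-1) (mergeOp ζ ψ) v := by
    intro v hv
    have h2 : ∀ u : List (Fin 2), u.length = N + 1 →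
        mergeOp ζ ψ₁ u = ∑ i : Fin 2, ![E, -1] i * mergeOp ζ (![ψ, ψ₂] i) u := by
      intro u hu
      rw [← mergeOp_sum]
      refine mergeOp_congr ζ (fun t ht => ?_) hu
      have := cycSum_supercharges ζ hN hψ ht
      rw [hE t ht] at this
      simp only [Fin.sum_univ_two, Matrix.cons_val_zero, Matrix.cons_val_one]
      linarith
    rw [cycSum_congr h2 hv, cycSum_sum]
    simp [Fin.sum_univ_two, hmerge v hv]
  rw [← hψ₁, splitOp_congr ζ hlin hv, splitOp_sum]
  simp

/-! ### Spin configurations, parity and connectivity -/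

/-- The eigenvalue of `pauli Axis.z` on a basis vector. -/
def spin (a : Fin 2) : ℝ := if a = 0 then 1 else -1

theorem spin_mul_self (a : Fin 2) : spin a * spin a = 1 := by
  fin_cases a <;> simp [spin]

theorem spin_add_one (a : Fin 2) : spin (a + 1) = -spin a := by
  fin_cases a <;> simp [spin]

theorem fin_two_add_one_add_one (a : Fin 2) : a + 1 + 1 = a := by
  fin_cases a <;> rfl

/-- The eigenvalue of the product of all `pauli Axis.z` on a basis configuration. -/
def parity {L : ℕ} (s : Config L) : ℝ := ∏ k, spin (s k)

theorem parity_mul_self {L : ℕ} (s : Config L) : parity s * parity s = 1 := by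
  rw [parity, ← Finset.prod_mul_distrib]
  exact Finset.prod_eq_one fun k _ => spin_mul_self _

theorem parity_eq {L : ℕ} (s : Config L) : parity s = 1 ∨ parity s = -1 :=
  mul_self_eq_one_iff.mp (parity_mul_self s)

/-- Flip the spins at the sites `i` and `k`. -/
def flipTwo {L : ℕ} (i k : Fin L) (s : Config L) : Config L :=
  fun l => if l = i ∨ l = k then s l + 1 else s l

theorem flipTwo_flipTwo {L : ℕ} (i k : Fin L) (s : Config L) :
    flipTwo i k (flipTwo i k s) = s := by
  funext l
  by_cases h : l = i ∨ l = k <;> simp [flipTwo, h, fin_two_add_one_add_one]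

theorem parity_flipTwo {L : ℕ} {i k : Fin L} (h : i ≠ k) (s : Config L) :
    parity (flipTwo i k s) = parity s := by
  have h1 : ∀ l, spin (flipTwo i k s l) =
      ((if l = i then -1 else 1) * (if l = k then -1 else 1)) * spin (s l) := by
    intro l
    by_cases h1 : l = i
    · have h2 : l ≠ k := h1 ▸ h
      simp [flipTwo, h1, h, spin_add_one]
    · by_cases h2 : l = k
      · simp [flipTwo, h2, Ne.symm h, spin_add_one]
      · simp [flipTwo, h1, h2]
  simp only [parity, h1, Finset.prod_mul_distrib]
  simp

/-- Flip all spins. -/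
def flipAll {L : ℕ} (s : Config L) : Config L := fun k => s k + 1

theorem flipAll_flipAll {L : ℕ} (s : Config L) : flipAll (flipAll s) = s :=
  funext fun _ => fin_two_add_one_add_one _

theorem parity_flipAll {n : ℕ} (s : Config (2 * n + 1)) : parity (flipAll s) = -parity s := by
  simp only [parity, flipAll, spin_add_one]
  rw [Finset.prod_neg]
  simp [pow_succ, pow_mul]

/-- The configuration with all spins down. -/
def allDown (L : ℕ) : Config L := fun _ => 1

theorem parity_allDown (n : ℕ) : parity (allDown (2 * n + 1)) = -1 := by
  simp [parity, allDown, spin, pow_succ, pow_mul]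

/-- Adjacent flips telescope: in a chain of them starting at site 0, every intermediate site is
flipped twice. -/
theorem flipTwo_closed {n : ℕ} {P : Config (2 * n + 1) → Prop}
    (hP : ∀ j s, P s → P (flipTwo j (j + 1) s)) (m : ℕ) (hm : m + 1 < 2 * n + 1)
    (s : Config (2 * n + 1)) (hs : P s) : P (flipTwo 0 ⟨m + 1, hm⟩ s) := by
  induction m with
  | zero =>
    convert hP 0 s hs using 2
    ext
    simp [Nat.mod_eq_of_lt hm]
  | succ m ih =>
    have h := hP ⟨m + 1, by omega⟩ _ (ih (by omega))
    have e : (⟨m + 1, by omega⟩ : Fin (2 * n + 1)) + 1 = ⟨m + 1 + 1, hm⟩ := by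
      ext
      rw [Fin.val_add, Fin.coe_ofNat_eq_mod, Nat.mod_eq_of_lt (by omega : 1 < 2 * n + 1),
        Nat.mod_eq_of_lt hm]
    rw [e] at h
    convert h using 1
    funext l
    have h0 : (0 : Fin (2 * n + 1)) ≠ ⟨m + 1, by omega⟩ := by
      intro h; simpa using congrArg Fin.val h
    have h0' : (0 : Fin (2 * n + 1)) ≠ ⟨m + 1 + 1, hm⟩ := by
      intro h; simpa using congrArg Fin.val h
    have h1 : (⟨m + 1, by omega⟩ : Fin (2 * n + 1)) ≠ ⟨m + 1 + 1, hm⟩ := by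
      intro h; simpa using congrArg Fin.val h
    by_cases a : l = 0
    · subst a; simp [flipTwo, h0, h0']
    · by_cases b : l = ⟨m + 1, by omega⟩
      · subst b; simp [flipTwo, a, h1, fin_two_add_one_add_one]
      · by_cases c : l = ⟨m + 1 + 1, hm⟩
        · subst c; simp [flipTwo, a, h1.symm]
        · simp [flipTwo, a, b, c]

theorem forall_parity_of_closed {n : ℕ} {P : Config (2 * n + 1) → Prop}
    (hP : ∀ j s, P s → P (flipTwo j (j + 1) s)) (hdown : P (allDown _))
    (s : Config (2 * n + 1)) (hs : parity s = -1) : P s := by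
  -- Induction on the set `U` of nonzero sites allowed to be up. A spin up at `k` is turned down
  -- together with a flip of site 0, and the parity finally fixes the spin at 0.
  have key : ∀ (U : Finset (Fin (2 * n + 1))) (s : Config (2 * n + 1)), 0 ∉ U →
      (∀ k, k ≠ 0 → k ∉ U → s k = 1) → parity s = -1 → P s := by
    intro U
    induction U using Finset.induction_on with
    | empty =>
      intro s _ h1 h2
      have h3 : s = allDown _ := by
        funext k
        by_cases hk : k = 0
        · subst hk
          rw [parity, Fin.prod_univ_succ, Finset.prod_congr rfl
            (fun i _ => by rw [h1 _ (Fin.succ_ne_zero i) (by simp)])] at h2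
          by_contra h
          have h4 : s 0 = 0 := by
            have h' : s 0 ≠ 1 := h
            omega
          rw [h4] at h2
          simp [spin, pow_mul] at h2
          norm_num at h2
        · exact h1 k hk (by simp)
      rw [h3]
      exact hdown
    | insert k U hk ih =>
      intro s h0 h1 h2
      rw [Finset.mem_insert, not_or] at h0
      have step : P (flipTwo 0 k s) ∨ P s := by
        by_cases h : s k = 1
        · exact Or.inr (ih s h0.2 (fun l hl hU => by
            by_cases hlk : l = k
            · rw [hlk, h]
            · exact h1 l hl (by simp [hlk, hU])) h2)
        · refine Or.inl (ih _ h0.2 (fun l hl hU => ?_) (by rw [parity_flipTwo h0.1, h2]))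
          by_cases hlk : l = k
          · have h4 : s k = 0 := by omega
            simp [flipTwo, hlk, h4]
          · simp [flipTwo, hlk, hl, h1 l hl (by simp [hlk, hU])]
      rcases step with h | h
      · obtain ⟨m, hm⟩ := Nat.exists_eq_succ_of_ne_zero
          (fun h => h0.1 (Fin.ext h.symm) : (k : ℕ) ≠ 0)
        have hm' : m + 1 < 2 * n + 1 := by omega
        obtain rfl : k = ⟨m + 1, hm'⟩ := Fin.ext hm
        have := flipTwo_closed hP m hm' _ h
        rwa [flipTwo_flipTwo] at this
      · exact h
  exact key (Finset.univ.erase 0) s (by simp) (fun k hk hU => by simp [hk] at hU) hs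

/-- The Hamiltonian, shifted by the supersymmetric ground-state energy, on real functions of
configurations. -/
noncomputable def gapOp (n : ℕ) (J : Axis → ℝ) (x : Config (2 * n + 1) → ℝ)
    (s : Config (2 * n + 1)) : ℝ :=
  1 / 2 * ∑ j, ((J .x + J .y + J .z - J .z * (spin (s j) * spin (s (j + 1)))) * x s -
    (J .x - J .y * (spin (s j) * spin (s (j + 1)))) * x (flipTwo j (j + 1) s))

/-- `x` is an eigenfunction of `gapOp` or zero. -/
def IsEigen (n : ℕ) (J : Axis → ℝ) (E : ℝ) (x : Config (2 * n + 1) → ℝ) : Prop :=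
  ∀ s, gapOp n J x s = E * x s

theorem gapOp_lin (n : ℕ) (J : Axis → ℝ) (a b : ℝ) (x y : Config (2 * n + 1) → ℝ)
    (s : Config (2 * n + 1)) :
    gapOp n J (fun t => a * x t + b * y t) s = a * gapOp n J x s + b * gapOp n J y s := by
  simp only [gapOp, Finset.mul_sum, ← Finset.sum_add_distrib]
  exact Finset.sum_congr rfl fun j _ => by ring

theorem IsEigen.lin {n : ℕ} {J : Axis → ℝ} {E : ℝ} {x y : Config (2 * n + 1) → ℝ}
    (hx : IsEigen n J E x) (hy : IsEigen n J E y) (a b : ℝ) :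
    IsEigen n J E (fun t => a * x t + b * y t) := fun s => by
  rw [gapOp_lin, hx, hy]
  ring

theorem IsEigen.flipAll {n : ℕ} {J : Axis → ℝ} {E : ℝ} {x : Config (2 * n + 1) → ℝ}
    (hx : IsEigen n J E x) : IsEigen n J E (fun s => x (flipAll s)) := fun s => by
  rw [← hx]
  have h : ∀ j, flipTwo j (j + 1) (XYZChain.flipAll s) =
      XYZChain.flipAll (flipTwo j (j + 1) s) := fun j => by
    funext l
    by_cases hl : l = j ∨ l = j + 1 <;> simp [flipTwo, XYZChain.flipAll, hl]
  simp only [gapOp, h]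
  simp only [XYZChain.flipAll, spin_add_one, neg_mul_neg]

/-- The cyclic shift of configurations. -/
def shift {n : ℕ} (s : Config (2 * n + 1)) : Config (2 * n + 1) := fun k => s (k + 1)

theorem IsEigen.shift {n : ℕ} {J : Axis → ℝ} {E : ℝ} {x : Config (2 * n + 1) → ℝ}
    (hx : IsEigen n J E x) : IsEigen n J E (fun s => x (shift s)) := fun s => by
  rw [← hx]
  have h : ∀ j, XYZChain.shift (flipTwo (j + 1) (j + 1 + 1) s) =
      flipTwo j (j + 1) (XYZChain.shift s) := fun j => by
    funext l
    simp [flipTwo, XYZChain.shift]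
  unfold gapOp
  rw [← Equiv.sum_comp (Equiv.addRight (1 : Fin (2 * n + 1)))]
  simp only [Equiv.coe_addRight, h]
  rfl

/-- The eigenvalue `E` of `gapOp` is a lower bound, attained exactly on eigenfunctions. -/
def IsLowest (n : ℕ) (J : Axis → ℝ) (E : ℝ) : Prop :=
  ∀ x : Config (2 * n + 1) → ℝ,
    ∑ s, x s * gapOp n J x s ≤ E * ∑ s, x s * x s → IsEigen n J E x

/-! ### Perron–Frobenius for the lowest eigenfunctions -/

section PerronFrobenius

variable {n : ℕ} {J : Axis → ℝ} {E : ℝ} {x : Config (2 * n + 1) → ℝ}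

theorem coupling_pos (h1 : J .y < J .x) (h2 : 0 < J .x + J .y) (a b : Fin 2) :
    0 < J .x - J .y * (spin a * spin b) := by
  fin_cases a <;> fin_cases b <;> simp [spin] <;> linarith

/-- The off-diagonal entries are nonpositive, so passing to `|x|` cannot raise the quadratic form
while it preserves the norm; `|x|` is then a minimizer too. -/
theorem IsEigen.abs (hE : IsLowest n J E) (h1 : J .y < J .x) (h2 : 0 < J .x + J .y)
    (hx : IsEigen n J E x) : IsEigen n J E (fun s => |x s|) := by
  apply hE
  have h3 : ∑ s, x s * gapOp n J x s = E * ∑ s, x s * x s := by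
    rw [Finset.mul_sum]
    exact Finset.sum_congr rfl fun s _ => by rw [hx]; ring
  simp only [abs_mul_abs_self]
  rw [← h3]
  refine Finset.sum_le_sum fun s _ => ?_
  unfold gapOp
  rw [mul_left_comm, mul_left_comm (x s)]
  refine mul_le_mul_of_nonneg_left ?_ (by norm_num)
  rw [Finset.mul_sum, Finset.mul_sum]
  refine Finset.sum_le_sum fun j _ => ?_
  have h4 := (coupling_pos h1 h2 (s j) (s (j + 1))).le
  have h5 : x s * x (flipTwo j (j + 1) s) ≤ |x s| * |x (flipTwo j (j + 1) s)| := by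
    rw [← abs_mul]
    exact le_abs_self _
  have h6 := mul_le_mul_of_nonneg_left h5 h4
  have h7 := abs_mul_abs_self (x s)
  linear_combination (J .x + J .y + J .z - J .z * (spin (s j) * spin (s (j + 1)))) * h7 + h6

/-- Where `|x|` vanishes, the eigenvalue equation is a vanishing sum of nonnegative terms with
positive couplings, so zeros spread along adjacent flips. -/
theorem IsEigen.eq_zero_of_parity (hE : IsLowest n J E) (h1 : J .y < J .x)
    (h2 : 0 < J .x + J .y) (hx : IsEigen n J E x) (h0 : x (allDown _) = 0)
    (s : Config (2 * n + 1)) (hs : parity s = -1) : x s = 0 := by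
  refine forall_parity_of_closed (P := fun s => x s = 0) (fun j s hs => ?_) h0 s hs
  have h3 := (hx.abs hE h1 h2) s
  simp only [gapOp, hs, abs_zero, mul_zero, zero_sub, Finset.sum_neg_distrib] at h3
  have h4 : ∑ j, (J .x - J .y * (spin (s j) * spin (s (j + 1)))) *
      |x (flipTwo j (j + 1) s)| = 0 := by linarith
  have h5 := (Finset.sum_eq_zero_iff_of_nonneg fun j _ =>
    mul_nonneg (coupling_pos h1 h2 _ _).le (abs_nonneg _)).mp h4 j (Finset.mem_univ j)
  exact abs_eq_zero.mp ((mul_eq_zero.mp h5).resolve_left (coupling_pos h1 h2 _ _).ne')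

theorem IsEigen.eq_zero (hE : IsLowest n J E) (h1 : J .y < J .x) (h2 : 0 < J .x + J .y)
    (hx : IsEigen n J E x) (h0 : x (allDown _) = 0) (h0' : x (XYZChain.flipAll (allDown _)) = 0) :
    x = 0 := by
  funext s
  rcases parity_eq s with hs | hs
  · have := hx.flipAll.eq_zero_of_parity hE h1 h2 h0' (XYZChain.flipAll s)
      (by rw [parity_flipAll, hs])
    simpa [flipAll_flipAll] using this
  · exact hx.eq_zero_of_parity hE h1 h2 h0 s hs

/-- The two uniform configurations are shift-invariant, and a lowest eigenfunction is determined by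
its values there. -/
theorem IsEigen.shift_eq (hE : IsLowest n J E) (h1 : J .y < J .x) (h2 : 0 < J .x + J .y)
    (hx : IsEigen n J E x) (s : Config (2 * n + 1)) : x (XYZChain.shift s) = x s := by
  have h := IsEigen.eq_zero hE h1 h2 (hx.shift.lin hx 1 (-1))
    (by change 1 * x (allDown _) + -1 * x (allDown _) = 0; ring)
    (by
      change 1 * x (XYZChain.flipAll (allDown _)) + -1 * x (XYZChain.flipAll (allDown _)) = 0
      ring)
  have := congrFun h s
  simp only [Pi.zero_apply] at this
  linarith

/-- On the parity class of the all-down configuration, `x` is proportional to `|x|`, so it has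
constant sign there and a positively weighted sum cannot cancel. The factor `1 - parity s` selects
that class. -/
theorem IsEigen.allDown_eq_zero (hE : IsLowest n J E) (h1 : J .y < J .x) (h2 : 0 < J .x + J .y)
    (hx : IsEigen n J E x) {w : Config (2 * n + 1) → ℝ} (hw : ∀ s, 0 < w s)
    (h : ∑ s, w s * (1 - parity s) * x s = 0) : x (allDown _) = 0 := by
  by_contra h0
  have hz := IsEigen.eq_zero_of_parity hE h1 h2
    ((hx.abs hE h1 h2).lin hx (x (allDown _)) (-|x (allDown _)|)) (by ring)
  have h3 : x (allDown _) * ∑ s, w s * (1 - parity s) * |x s| = 0 := by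
    have : x (allDown _) * ∑ s, w s * (1 - parity s) * |x s| =
        |x (allDown _)| * ∑ s, w s * (1 - parity s) * x s := by
      rw [Finset.mul_sum, Finset.mul_sum]
      refine Finset.sum_congr rfl fun s _ => ?_
      rcases parity_eq s with hs | hs
      · rw [hs]; ring
      · linear_combination w s * (1 - parity s) * hz s hs
    rw [this, h, mul_zero]
  have h4 := (Finset.sum_eq_zero_iff_of_nonneg fun s _ => ?_).mp
    ((mul_eq_zero.mp h3).resolve_left h0) (allDown _) (Finset.mem_univ _)
  · rw [parity_allDown, mul_eq_zero, abs_eq_zero] at h4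
    rcases h4 with h4 | h4
    · have := hw (allDown _)
      linarith
    · exact h0 h4
  · refine mul_nonneg (mul_nonneg (hw s).le ?_) (abs_nonneg _)
    rcases parity_eq s with hs | hs <;> rw [hs] <;> norm_num

theorem IsEigen.eq_zero_of_sum (hE : IsLowest n J E) (h1 : J .y < J .x) (h2 : 0 < J .x + J .y)
    (hx : IsEigen n J E x) {w : Config (2 * n + 1) → ℝ} (hw : ∀ s, 0 < w s)
    (h : ∑ s, w s * x s = 0) (h' : ∑ s, w s * parity s * x s = 0) : x = 0 := by
  refine hx.eq_zero hE h1 h2 (hx.allDown_eq_zero hE h1 h2 hw ?_)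
    (hx.flipAll.allDown_eq_zero hE h1 h2 (w := fun s => w (XYZChain.flipAll s))
      (fun s => hw _) ?_)
  · have : ∑ s, w s * (1 - parity s) * x s = ∑ s, w s * x s - ∑ s, w s * parity s * x s := by
      rw [← Finset.sum_sub_distrib]
      exact Finset.sum_congr rfl fun s _ => by ring
    rw [this, h, h', sub_zero]
  · have h3 : ∑ s, w (XYZChain.flipAll s) * (1 + parity (XYZChain.flipAll s)) *
        x (XYZChain.flipAll s) = ∑ s, w s * (1 + parity s) * x s :=
      Equiv.sum_comp (Function.Involutive.toPerm XYZChain.flipAll flipAll_flipAll)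
        (fun s : Config (2 * n + 1) => w s * (1 + parity s) * x s)
    have : ∑ s, w s * (1 + parity s) * x s = ∑ s, w s * x s + ∑ s, w s * parity s * x s := by
      rw [← Finset.sum_add_distrib]
      exact Finset.sum_congr rfl fun s _ => by ring
    rw [this, h, h', add_zero] at h3
    rw [← h3]
    exact Finset.sum_congr rfl fun s _ => by rw [parity_flipAll]; ring

end PerronFrobenius

/-! ### From words to the chain: the lowest energy is zero -/

/-- A function of configurations, viewed as a function of words. -/
def toWord {L : ℕ} (x : Config L → ℝ) : List (Fin 2) → ℝ :=
  fun w => x (fun i => w.getD i 0)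

theorem toWord_ofFn {L : ℕ} (x : Config L → ℝ) (s : Config L) : toWord x (List.ofFn s) = x s := by
  simp [toWord]

theorem exists_eq_ofFn {α : Type*} {L : ℕ} {w : List α} (hw : w.length = L) :
    ∃ s : Fin L → α, w = List.ofFn s := by
  subst hw
  exact ⟨w.get, (List.ofFn_get w).symm⟩

theorem ofFn_rotate {n : ℕ} (s : Config (2 * n + 1)) (k : ℕ) :
    (List.ofFn s).rotate k = List.ofFn (shift^[k] s) := by
  induction k generalizing s with
  | zero => simp
  | succ k ih =>
    have h : ∀ t : Config (2 * n + 1), (List.ofFn t).rotate 1 = List.ofFn (shift t) := by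
      intro t
      refine List.ext_getElem (by simp) fun i h1 h2 => ?_
      simp only [List.getElem_rotate, List.getElem_ofFn, List.length_ofFn, shift]
      congr 1
      ext
      simp only [List.length_ofFn] at h2
      rw [Fin.val_add]
      simp
    rw [← List.rotate_rotate, ih, h, Function.iterate_succ_apply']

theorem isCyclic_toWord {n : ℕ} {x : Config (2 * n + 1) → ℝ} (hx : ∀ s, x (shift s) = x s) :
    IsCyclic 1 (2 * n + 1) (toWord x) := by
  intro w hw
  obtain ⟨s, rfl⟩ := exists_eq_ofFn hw
  rw [ofFn_rotate, toWord_ofFn, toWord_ofFn, one_mul, Function.iterate_one, hx]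

theorem iterate_shift {n : ℕ} (s : Config (2 * n + 1)) (j : Fin (2 * n + 1)) :
    shift^[(j : ℕ)] s = fun i => s (i + j) := by
  have h : ∀ k : ℕ, shift^[k] s =
      fun i : Fin (2 * n + 1) => s ⟨((i : ℕ) + k) % (2 * n + 1), Nat.mod_lt _ (Nat.succ_pos _)⟩ := by
    intro k
    induction k with
    | zero =>
      funext i
      simp [Nat.mod_eq_of_lt i.2]
    | succ k ih =>
      rw [Function.iterate_succ_apply', ih]
      funext i
      simp only [shift]
      congr 1
      ext
      simp [Fin.val_add, add_assoc, add_comm 1 k]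
  rw [h]
  rfl

theorem localOp_ofFn (ζ : ℝ) {M : ℕ} (φ : List (Fin 2) → ℝ) (t : Config (M + 2)) :
    localOp ζ φ (List.ofFn t) =
      if t 0 = t 1 then φ (List.ofFn t) - ζ * φ (List.ofFn (flipTwo 0 1 t))
      else (1 + ζ ^ 2) / 2 * φ (List.ofFn t) - φ (List.ofFn (flipTwo 0 1 t)) := by
  have h : List.ofFn (flipTwo 0 1 t) =
      (t 0 + 1) :: (t 1 + 1) :: List.ofFn (fun i : Fin M => t i.succ.succ) := by
    rw [List.ofFn_succ, List.ofFn_succ]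
    simp [flipTwo, Fin.succ_ne_zero, Fin.succ_succ_ne_one]
  rw [h, List.ofFn_succ, List.ofFn_succ]
  rfl

/-- The supersymmetric couplings with parameters `lam` and `ζ`. -/
def IsCoupling (J : Axis → ℝ) (lam ζ : ℝ) : Prop :=
  J .x = lam * (1 + ζ) ∧ J .y = lam * (1 - ζ) ∧ J .z = lam * ((ζ ^ 2 - 1) / 2)

/-- By shift invariance, the bond at site `j` acts as the two-letter density on the `j`-th rotation
of the word. It then remains to compare four spin patterns. -/
theorem gapOp_eq_cycSum {n : ℕ} (hn : 1 ≤ n) {J : Axis → ℝ} {lam ζ : ℝ} (hJ : IsCoupling J lam ζ)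
    {x : Config (2 * n + 1) → ℝ} (hx : ∀ s, x (shift s) = x s) (s : Config (2 * n + 1)) :
    gapOp n J x s = lam * cycSum 1 (localOp ζ (toWord x)) (List.ofFn s) := by
  have hloc : ∀ t : Config (2 * n + 1), localOp ζ (toWord x) (List.ofFn t) =
      if t 0 = t 1 then x t - ζ * x (flipTwo 0 1 t)
      else (1 + ζ ^ 2) / 2 * x t - x (flipTwo 0 1 t) := by
    intro t
    obtain ⟨p, rfl⟩ : ∃ p, n = p + 1 := ⟨n - 1, by omega⟩
    have := localOp_ofFn (M := 2 * p + 1) ζ (toWord x) t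
    rw [toWord_ofFn x t] at this
    refine this.trans ?_
    have h2 := toWord_ofFn x (flipTwo 0 1 t)
    exact if_congr Iff.rfl (congrArg (fun y => x t - ζ * y) h2)
      (congrArg (fun y => (1 + ζ ^ 2) / 2 * x t - y) h2)
  have hk : ∀ (k : ℕ) t, x (shift^[k] t) = x t := by
    intro k
    induction k with
    | zero => intro t; rfl
    | succ k ih => intro t; rw [Function.iterate_succ_apply, ih, hx]
  unfold cycSum
  rw [List.length_ofFn, Finset.sum_range, gapOp, Finset.mul_sum, Finset.mul_sum]
  refine Finset.sum_congr rfl fun j _ => ?_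
  have hflip : flipTwo 0 1 (shift^[(j : ℕ)] s) = shift^[(j : ℕ)] (flipTwo j (j + 1) s) := by
    rw [iterate_shift, iterate_shift]
    funext l
    have e1 : l + j = j + 1 ↔ l = 1 := by rw [add_comm j 1, add_left_inj]
    simp [flipTwo, e1]
  rw [ofFn_rotate, hloc, hflip, hk, hk, iterate_shift, one_pow, one_mul]
  simp only [zero_add, add_comm 1 j]
  obtain ⟨h1, h2, h3⟩ := hJ
  rw [h1, h2, h3]
  generalize s j = a
  generalize s (j + 1) = b
  fin_cases a <;> fin_cases b <;> simp [spin] <;> ring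

theorem sum_of_wordSum {n : ℕ} {w : Fin 2 → ℝ} {φ : List (Fin 2) → ℝ}
    (h : wordSum w (2 * n + 1) φ = 0) :
    ∑ s : Config (2 * n + 1), (∏ i, w (s i)) * φ (List.ofFn s) = 0 := by
  rw [← wordSum_eq_sum, h]

/-- Both halves of the anticommutator map a lowest eigenfunction to eigenfunctions of the same
eigenvalue. These are orthogonal to positive weights in both parity classes, hence zero, so `E`
times the original function is zero. -/
theorem lowest_eq_zero {n : ℕ} (hn : 1 ≤ n) {J : Axis → ℝ} {lam ζ E : ℝ} (hlam : 0 < lam)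
    (hζ : 0 < ζ) (hJ : IsCoupling J lam ζ) (hE : IsLowest n J E) {x : Config (2 * n + 1) → ℝ}
    (hx : IsEigen n J E x) (hx0 : x ≠ 0) : E = 0 := by
  have h1 : J .y < J .x := by
    rw [hJ.1, hJ.2.1]
    nlinarith
  have h2 : 0 < J .x + J .y := by
    rw [hJ.1, hJ.2.1]
    nlinarith
  have hxs := hx.shift_eq hE h1 h2
  obtain ⟨N, hN, hNn⟩ : ∃ N, Odd N ∧ N + 2 = 2 * n + 1 :=
    ⟨2 * (n - 1) + 1, ⟨n - 1, rfl⟩, by omega⟩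
  set ψ := toWord x with hψ
  have hcyc : IsCyclic 1 (N + 2) ψ := hNn ▸ isCyclic_toWord hxs
  have hloc : ∀ w : List (Fin 2), w.length = N + 2 →
      cycSum 1 (localOp ζ ψ) w = E / lam * ψ w := by
    intro w hw
    obtain ⟨s, rfl⟩ := exists_eq_ofFn (hw.trans hNn)
    have := gapOp_eq_cycSum hn hJ hxs s
    rw [hx] at this
    rw [hψ, toWord_ofFn]
    field_simp
    linarith
  set ψ₁ := cycSum 1 (splitOp ζ (cycSum (-1) (mergeOp ζ ψ))) with hψ₁
  set ψ₂ := cycSum 1 (mergeOp ζ (cycSum (-1) (splitOp ζ ψ))) with hψ₂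
  have hcyc₁ : IsCyclic 1 (N + 2) ψ₁ := cycSum_rotate (by norm_num) (one_pow _) _
  set x₁ : Config (2 * n + 1) → ℝ := fun s => ψ₁ (List.ofFn s) with hx₁
  set x₂ : Config (2 * n + 1) → ℝ := fun s => ψ₂ (List.ofFn s) with hx₂
  have hadd : ∀ s, x₁ s + x₂ s = E / lam * x s := by
    intro s
    have hs : (List.ofFn s).length = N + 2 := by simp [hNn]
    have := cycSum_supercharges ζ hN hcyc hs
    rwa [hloc _ hs, hψ, toWord_ofFn] at this
  have hx₁s : ∀ s, x₁ (shift s) = x₁ s := by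
    intro s
    have := hcyc₁ (List.ofFn s) (by simp [hNn])
    rwa [ofFn_rotate, one_mul, Function.iterate_one] at this
  have hword : ∀ w : List (Fin 2), w.length = N + 2 → toWord x₁ w = ψ₁ w := by
    intro w hw
    obtain ⟨s, rfl⟩ := exists_eq_ofFn (hw.trans hNn)
    rw [toWord_ofFn]
  have heig₁ : IsEigen n J E x₁ := by
    intro s
    have hs : (List.ofFn s).length = N + 2 := by simp [hNn]
    have hl : ∀ w : List (Fin 2), w.length = N + 2 →
        localOp ζ (toWord x₁) w = localOp ζ ψ₁ w := by
      intro w hw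
      match w, hw with
      | a :: b :: w, hw =>
        simp only [localOp]
        rw [hword _ hw, hword _ (by simpa using hw)]
    rw [gapOp_eq_cycSum hn hJ hx₁s, cycSum_congr hl hs,
      cycSum_localOp_supercharge ζ (E / lam) hN hcyc hloc hs]
    change lam * (E / lam * x₁ s) = E * x₁ s
    field_simp
  have heig₂ : IsEigen n J E x₂ := by
    have : x₂ = fun s => E / lam * x s + (-1) * x₁ s := by
      funext s
      linarith [hadd s]
    rw [this]
    exact hx.lin heig₁ _ _
  -- The square roots $\pm r$ give the two idempotents and the two characters. Passing from $r$ to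
  -- $-r$ multiplies the weight by the parity, up to a global sign, which yields both sums needed
  -- for `IsEigen.eq_zero_of_sum`.
  set r := Real.sqrt ζ with hr
  have hr0 : 0 < r := Real.sqrt_pos.mpr hζ
  have hr2 : r ^ 2 = ζ := Real.sq_sqrt hζ.le
  have hz₁ : x₁ = 0 := by
    have e := sum_of_wordSum (hNn ▸ wordSum_supercharge_split hr0.ne' hr2 hN (mergeOp ζ ψ))
    have e' := sum_of_wordSum (hNn ▸ wordSum_supercharge_split (neg_ne_zero.mpr hr0.ne')
      (by rw [neg_sq, hr2]) hN (mergeOp ζ ψ))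
    refine heig₁.eq_zero_of_sum hE h1 h2 (w := fun s => ∏ i, ![r, 1] (s i)) (fun s => ?_) e ?_
    · exact Finset.prod_pos fun i _ => by
        generalize s i = a
        fin_cases a <;> simp [hr0]
    · rw [← neg_eq_zero, ← Finset.sum_neg_distrib, ← e']
      refine Finset.sum_congr rfl fun s _ => ?_
      have : ∀ a : Fin 2, ![-r, 1] a = -(![r, 1] a * spin a) := by
        intro a
        fin_cases a <;> simp [spin]
      simp only [this, Finset.prod_neg, Finset.prod_mul_distrib, parity]
      simp [pow_succ, pow_mul, hx₁, hψ₁]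
  have hz₂ : x₂ = 0 := by
    have e := sum_of_wordSum (hNn ▸ wordSum_supercharge_merge hr0.ne' hr2 hN (splitOp ζ ψ))
    have e' := sum_of_wordSum (hNn ▸ wordSum_supercharge_merge (neg_ne_zero.mpr hr0.ne')
      (by rw [neg_sq, hr2]) hN (splitOp ζ ψ))
    refine heig₂.eq_zero_of_sum hE h1 h2 (w := fun s => ∏ i, ![1, r] (s i)) (fun s => ?_) e ?_
    · exact Finset.prod_pos fun i _ => by
        generalize s i = a
        fin_cases a <;> simp [hr0]
    · rw [← e']
      refine Finset.sum_congr rfl fun s _ => ?_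
      have : ∀ a : Fin 2, ![1, -r] a = ![1, r] a * spin a := by
        intro a
        fin_cases a <;> simp [spin]
      simp only [this, Finset.prod_mul_distrib, parity]
      rfl
  obtain ⟨s, hs⟩ := Function.ne_iff.mp hx0
  have := hadd s
  simp only [hz₁, hz₂, Pi.zero_apply, add_zero, zero_eq_mul] at this
  rcases this with h | h
  · exact (div_eq_zero_iff.mp h).resolve_right hlam.ne'
  · exact absurd h hs

/-! ### Matrix form and permutation of the axes -/

open Matrix

instance : DecidableEq Axis := fun a b => by
  cases a <;> cases b <;> first | exact isTrue rfl | exact isFalse (by nofun)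

instance : Fintype Axis := ⟨{.x, .y, .z}, fun a => by cases a <;> simp⟩

theorem sum_axis {M : Type*} [AddCommMonoid M] (f : Axis → M) :
    ∑ a, f a = f .x + f .y + f .z := by
  change ∑ a ∈ {Axis.x, Axis.y, Axis.z}, f a = _
  rw [Finset.sum_insert (by simp), Finset.sum_insert (by simp), Finset.sum_singleton, add_assoc]

/-- The tensor product of a family of one-site operators. -/
def prodMat {L : ℕ} (A : Fin L → Matrix (Fin 2) (Fin 2) ℂ) : Matrix (Config L) (Config L) ℂ :=
  Matrix.of fun s t => ∏ k, A k (s k) (t k)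

theorem prodMat_mul {L : ℕ} (A B : Fin L → Matrix (Fin 2) (Fin 2) ℂ) :
    prodMat A * prodMat B = prodMat (fun k => A k * B k) := by
  ext s t
  simp only [prodMat, Matrix.mul_apply, Matrix.of_apply, ← Finset.prod_mul_distrib]
  rw [Finset.prod_univ_sum, Fintype.piFinset_univ]

theorem prodMat_one {L : ℕ} : prodMat (fun _ : Fin L => 1) = 1 := by
  ext s t
  simp only [prodMat, Matrix.of_apply, Matrix.one_apply]
  by_cases h : s = t
  · simp [h]
  · obtain ⟨k, hk⟩ := Function.ne_iff.mp h
    rw [if_neg h]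
    exact Finset.prod_eq_zero (Finset.mem_univ k) (if_neg hk)

theorem prodMat_conjTranspose {L : ℕ} (A : Fin L → Matrix (Fin 2) (Fin 2) ℂ) :
    (prodMat A)ᴴ = prodMat (fun k => (A k)ᴴ) := by
  ext s t
  simp [prodMat, Matrix.conjTranspose_apply]

theorem siteMatrix_eq_prodMat {L : ℕ} (A : Matrix (Fin 2) (Fin 2) ℂ) (j : Fin L) :
    siteMatrix A j = prodMat (fun k => if k = j then A else 1) := by
  ext s t
  simp only [siteMatrix, prodMat, Matrix.of_apply]
  rw [← Finset.mul_prod_erase _ _ (Finset.mem_univ j), if_pos rfl]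
  by_cases h : ∀ k, k ≠ j → s k = t k
  · rw [if_pos h, Finset.prod_eq_one, mul_one]
    intro k hk
    rw [if_neg (Finset.ne_of_mem_erase hk), h k (Finset.ne_of_mem_erase hk), Matrix.one_apply_eq]
  · rw [if_neg h]
    push Not at h
    obtain ⟨k, hk, hne⟩ := h
    rw [Finset.prod_eq_zero (Finset.mem_erase.mpr ⟨hk, Finset.mem_univ k⟩), mul_zero]
    rw [if_neg hk, Matrix.one_apply_ne hne]

/-- The matrix of `pairOp`. -/
def pairMat (n : ℕ) (a : Axis) (j : Fin (2 * n + 1)) :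
    Matrix (Config (2 * n + 1)) (Config (2 * n + 1)) ℂ :=
  siteMatrix (pauli a) j * siteMatrix (pauli a) (j + 1)

theorem pauli_conjTranspose (a : Axis) : (pauli a)ᴴ = pauli a := by
  ext i j
  cases a <;> fin_cases i <;> fin_cases j <;> simp [pauli, Matrix.conjTranspose_apply]

theorem pauli_mul_self (a : Axis) : pauli a * pauli a = 1 := by
  ext i j
  cases a <;> fin_cases i <;> fin_cases j <;> simp [pauli]

theorem siteMatrix_comm {L : ℕ} (A : Matrix (Fin 2) (Fin 2) ℂ) (i j : Fin L) :
    siteMatrix A i * siteMatrix A j = siteMatrix A j * siteMatrix A i := by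
  rw [siteMatrix_eq_prodMat, siteMatrix_eq_prodMat, prodMat_mul, prodMat_mul]
  congr 1
  funext k
  split_ifs <;> simp

theorem siteMatrix_conjTranspose {L : ℕ} (A : Matrix (Fin 2) (Fin 2) ℂ) (j : Fin L) :
    (siteMatrix A j)ᴴ = siteMatrix Aᴴ j := by
  rw [siteMatrix_eq_prodMat, siteMatrix_eq_prodMat, prodMat_conjTranspose]
  congr 1
  funext k
  split_ifs <;> simp

theorem pairMat_isHermitian (n : ℕ) (a : Axis) (j : Fin (2 * n + 1)) :
    (pairMat n a j).IsHermitian := by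
  rw [Matrix.IsHermitian, pairMat, Matrix.conjTranspose_mul, siteMatrix_conjTranspose,
    siteMatrix_conjTranspose, pauli_conjTranspose, siteMatrix_comm]

/-- The tensor power of a one-site operator. -/
def tensorPow (L : ℕ) (U : Matrix (Fin 2) (Fin 2) ℂ) : Matrix (Config L) (Config L) ℂ :=
  prodMat fun _ => U

theorem tensorPow_mul_self {L : ℕ} {U : Matrix (Fin 2) (Fin 2) ℂ} (hU : U * U = 1) :
    tensorPow L U * tensorPow L U = 1 := by
  rw [tensorPow, prodMat_mul, hU, prodMat_one]

theorem tensorPow_isHermitian {L : ℕ} {U : Matrix (Fin 2) (Fin 2) ℂ} (hU : Uᴴ = U) :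
    (tensorPow L U).IsHermitian := by
  rw [Matrix.IsHermitian, tensorPow, prodMat_conjTranspose, hU]

theorem siteMatrix_smul {L : ℕ} (c : ℂ) (A : Matrix (Fin 2) (Fin 2) ℂ) (j : Fin L) :
    siteMatrix (c • A) j = c • siteMatrix A j := by
  ext s t
  simp [siteMatrix]

theorem tensorPow_conj_siteMatrix {L : ℕ} {U : Matrix (Fin 2) (Fin 2) ℂ} (hU : U * U = 1)
    (A : Matrix (Fin 2) (Fin 2) ℂ) (j : Fin L) :
    tensorPow L U * siteMatrix A j * tensorPow L U = siteMatrix (U * A * U) j := by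
  rw [siteMatrix_eq_prodMat, siteMatrix_eq_prodMat, tensorPow, prodMat_mul, prodMat_mul]
  congr 1
  funext k
  split_ifs <;> simp [hU]

/-- Each Pauli matrix occurs twice, so the sign picked up under conjugation squares away. -/
theorem tensorPow_conj_pairMat {n : ℕ} {U : Matrix (Fin 2) (Fin 2) ℂ} (hU : U * U = 1)
    {a b : Axis} {ε : ℂ} (hε : ε * ε = 1) (h : U * pauli a * U = ε • pauli b)
    (j : Fin (2 * n + 1)) :
    tensorPow _ U * pairMat n a j * tensorPow _ U = pairMat n b j := by
  have h1 : tensorPow _ U * pairMat n a j * tensorPow _ U =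
      (tensorPow _ U * siteMatrix (pauli a) j * tensorPow _ U) *
        (tensorPow _ U * siteMatrix (pauli a) (j + 1) * tensorPow _ U) := by
    calc _ = tensorPow _ U * siteMatrix (pauli a) j * 1 *
          siteMatrix (pauli a) (j + 1) * tensorPow _ U := by
            rw [pairMat, Matrix.mul_one]
            simp only [Matrix.mul_assoc]
      _ = _ := by
            rw [← tensorPow_mul_self hU]
            simp only [Matrix.mul_assoc]
  rw [h1, tensorPow_conj_siteMatrix hU, tensorPow_conj_siteMatrix hU, h, siteMatrix_smul,
    siteMatrix_smul, Matrix.smul_mul, Matrix.mul_smul, smul_smul, hε, one_smul, pairMat]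

/-- The Hamiltonian shifted by the supersymmetric ground-state energy. -/
noncomputable def gapMat (n : ℕ) (J : Axis → ℂ) :
    Matrix (Config (2 * n + 1)) (Config (2 * n + 1)) ℂ :=
  (1 / 2 : ℂ) • ∑ j, ∑ a, J a • (1 - pairMat n a j)

theorem tensorPow_conj_gapMat {n : ℕ} {U : Matrix (Fin 2) (Fin 2) ℂ} (hU : U * U = 1)
    (e : Equiv.Perm Axis) (h : ∀ a, ∃ ε : ℂ, ε * ε = 1 ∧ U * pauli a * U = ε • pauli (e a))
    (J : Axis → ℂ) :
    tensorPow _ U * gapMat n (fun a => J (e a)) * tensorPow _ U = gapMat n J := by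
  have hp : ∀ a j, tensorPow _ U * pairMat n a j * tensorPow _ U = pairMat n (e a) j := by
    intro a j
    obtain ⟨ε, hε, h⟩ := h a
    exact tensorPow_conj_pairMat hU hε h j
  simp only [gapMat, Matrix.mul_smul, Matrix.smul_mul, Finset.mul_sum, Finset.sum_mul,
    Matrix.mul_sub, Matrix.sub_mul, Matrix.mul_one, tensorPow_mul_self hU, hp]
  congr 1
  exact Finset.sum_congr rfl fun j _ => Equiv.sum_comp e fun a => J a • (1 - pairMat n a j)

theorem gapMat_isHermitian (n : ℕ) (J : Axis → ℝ) :
    (gapMat n fun a => (J a : ℂ)).IsHermitian := by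
  simp only [Matrix.IsHermitian, gapMat, Matrix.conjTranspose_smul, Matrix.conjTranspose_sum,
    Matrix.conjTranspose_sub, Matrix.conjTranspose_one, (pairMat_isHermitian n _ _).eq]
  simp

/-- The Hadamard-type involution exchanging the axes `a` and `b`. -/
noncomputable def swapMat (a b : Axis) : Matrix (Fin 2) (Fin 2) ℂ :=
  ((1 / Real.sqrt 2 : ℝ) : ℂ) • (pauli a + pauli b)

theorem sqrt_two_inv_sq : ((1 / Real.sqrt 2 : ℝ) : ℂ) * ((1 / Real.sqrt 2 : ℝ) : ℂ) = 1 / 2 := by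
  rw [← Complex.ofReal_mul, div_mul_div_comm, Real.mul_self_sqrt (by norm_num)]
  norm_num

theorem swapMat_conjTranspose (a b : Axis) : (swapMat a b)ᴴ = swapMat a b := by
  rw [swapMat, Matrix.conjTranspose_smul, Matrix.conjTranspose_add, pauli_conjTranspose,
    pauli_conjTranspose]
  simp

theorem swapMat_mul_self {a b : Axis} (h : a ≠ b) : swapMat a b * swapMat a b = 1 := by
  rw [swapMat, Matrix.smul_mul, Matrix.mul_smul, smul_smul, sqrt_two_inv_sq]
  ext i j
  cases a <;> cases b <;> first | exact absurd rfl h | skip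
  all_goals
    fin_cases i <;> fin_cases j <;> simp [pauli] <;> ring_nf <;> simp <;> norm_num

/-- Conjugation is the half-turn about the bisector of the two axes: it exchanges them and reverses
the third, hence the sign $-1$ there. -/
theorem swapMat_conj_pauli {a b : Axis} (h : a ≠ b) (c : Axis) :
    ∃ ε : ℂ, ε * ε = 1 ∧
      swapMat a b * pauli c * swapMat a b = ε • pauli (Equiv.swap a b c) := by
  refine ⟨if c = a ∨ c = b then 1 else -1, by split_ifs <;> norm_num, ?_⟩
  rw [swapMat, Matrix.smul_mul, Matrix.smul_mul, Matrix.mul_smul, smul_smul, sqrt_two_inv_sq]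
  ext i j
  cases a <;> cases b <;> first | exact absurd rfl h | skip
  all_goals
    cases c <;> fin_cases i <;> fin_cases j <;>
      simp [pauli, Equiv.swap_apply_def] <;>
      ring_nf <;> simp <;> ring_nf

theorem siteMatrix_mulVec {L : ℕ} (A : Matrix (Fin 2) (Fin 2) ℂ) (j : Fin L) (Ψ : Config L → ℂ)
    (s : Config L) :
    (siteMatrix A j *ᵥ Ψ) s = ∑ b, A (s j) b * Ψ (Function.update s j b) := by
  rw [Matrix.mulVec, dotProduct]
  symm
  refine Finset.sum_of_injOn (fun b => Function.update s j b)
    (fun b _ c _ h => by simpa using congrFun h j) (by simp) (fun t _ ht => ?_) (fun b _ => ?_)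
  · rw [siteMatrix, Matrix.of_apply, if_neg, zero_mul]
    intro h
    apply ht
    refine ⟨t j, by simp, ?_⟩
    funext k
    by_cases hk : k = j
    · subst hk; simp
    · simp [hk, h k hk]
  · rw [siteMatrix, Matrix.of_apply, if_pos]
    · simp
    · intro k hk
      simp [hk]

theorem update_update_eq_flipTwo {L : ℕ} {i j : Fin L} (h : i ≠ j) (s : Config L) :
    Function.update (Function.update s i (s i + 1)) j (s j + 1) = flipTwo i j s := by
  funext k
  by_cases hj : k = j
  · subst hj; simp [flipTwo]
  · by_cases hi : k = i
    · subst hi; simp [flipTwo, hj]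
    · simp [flipTwo, hi, hj]

theorem siteMatrix_pauli_mulVec {L : ℕ} (j : Fin L) (Ψ : Config L → ℂ) (s : Config L) :
    (siteMatrix (pauli .x) j *ᵥ Ψ) s = Ψ (Function.update s j (s j + 1)) ∧
    (siteMatrix (pauli .y) j *ᵥ Ψ) s =
      -Complex.I * spin (s j) * Ψ (Function.update s j (s j + 1)) ∧
    (siteMatrix (pauli .z) j *ᵥ Ψ) s = spin (s j) * Ψ s := by
  have h : Function.update s j (s j) = s := Function.update_eq_self j s
  simp only [siteMatrix_mulVec, Fin.sum_univ_two]
  obtain h' | h' : s j = 0 ∨ s j = 1 := by omega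
  all_goals
    rw [h'] at h ⊢
    simp [pauli, spin, h]

theorem pairMat_mulVec {n : ℕ} (hn : 1 ≤ n) (j : Fin (2 * n + 1)) (Ψ : Config (2 * n + 1) → ℂ)
    (s : Config (2 * n + 1)) :
    (pairMat n .x j *ᵥ Ψ) s = Ψ (flipTwo j (j + 1) s) ∧
    (pairMat n .y j *ᵥ Ψ) s = -(spin (s j) * spin (s (j + 1))) * Ψ (flipTwo j (j + 1) s) ∧
    (pairMat n .z j *ᵥ Ψ) s = (spin (s j) * spin (s (j + 1))) * Ψ s := by
  have hj : j ≠ j + 1 := by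
    intro h
    have h1 : (1 : Fin (2 * n + 1)) = 0 := by simpa using h.symm
    have := congrArg Fin.val h1
    rw [Fin.coe_ofNat_eq_mod, Nat.mod_eq_of_lt (by omega)] at this
    simp at this
  simp only [pairMat, ← Matrix.mulVec_mulVec]
  refine ⟨?_, ?_, ?_⟩
  · rw [(siteMatrix_pauli_mulVec j _ s).1, (siteMatrix_pauli_mulVec (j + 1) Ψ _).1,
      Function.update_of_ne hj.symm, update_update_eq_flipTwo hj]
  · rw [(siteMatrix_pauli_mulVec j _ s).2.1, (siteMatrix_pauli_mulVec (j + 1) Ψ _).2.1,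
      Function.update_of_ne hj.symm, update_update_eq_flipTwo hj]
    linear_combination (spin (s j) * spin (s (j + 1)) * Ψ (flipTwo j (j + 1) s)) * Complex.I_mul_I
  · rw [(siteMatrix_pauli_mulVec j _ s).2.2, (siteMatrix_pauli_mulVec (j + 1) Ψ _).2.2]
    ring

/-- The matrix is real in the $\sigma^z$ basis, so real and imaginary parts of a vector evolve
separately and the real Perron–Frobenius results apply. -/
theorem gapMat_mulVec {n : ℕ} (hn : 1 ≤ n) (J : Axis → ℝ) (Ψ : Config (2 * n + 1) → ℂ)
    (s : Config (2 * n + 1)) :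
    (gapMat n (fun a => (J a : ℂ)) *ᵥ Ψ) s =
      gapOp n J (fun t => (Ψ t).re) s + gapOp n J (fun t => (Ψ t).im) s * Complex.I := by
  have h : (gapMat n (fun a => (J a : ℂ)) *ᵥ Ψ) s =
      1 / 2 * ∑ j, ((J .x + J .y + J .z - J .z * (spin (s j) * spin (s (j + 1)))) * Ψ s -
    (J .x - J .y * (spin (s j) * spin (s (j + 1)))) * Ψ (flipTwo j (j + 1) s)) := by
    simp only [gapMat, Matrix.smul_mulVec, Matrix.sum_mulVec, sum_axis, Matrix.add_mulVec,
      Matrix.sub_mulVec, Matrix.one_mulVec, Pi.smul_apply, Finset.sum_apply, Pi.add_apply,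
      Pi.sub_apply, smul_eq_mul]
    congr 1
    refine Finset.sum_congr rfl fun j _ => ?_
    obtain ⟨h1, h2, h3⟩ := pairMat_mulVec hn j Ψ s
    rw [h1, h2, h3]
    ring
  rw [h]
  simp only [gapOp, Finset.mul_sum, Complex.ofReal_sum, Finset.sum_mul, ← Finset.sum_add_distrib]
  refine Finset.sum_congr rfl fun j _ => ?_
  conv_lhs => rw [← Complex.re_add_im (Ψ s), ← Complex.re_add_im (Ψ (flipTwo j (j + 1) s))]
  push_cast
  ring

/-! ### Positivity, the two-dimensional kernel and its correlations -/

open Polynomial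
open scoped ComplexOrder

theorem exists_lowest_eigenvector {ι : Type*} [Fintype ι] [DecidableEq ι] [Nonempty ι]
    {A : Matrix ι ι ℂ} (hA : A.IsHermitian) :
    ∃ E : ℝ, (A - (E : ℂ) • (1 : Matrix ι ι ℂ)).PosSemidef ∧
      ∃ v : ι → ℂ, v ≠ 0 ∧ A *ᵥ v = (E : ℂ) • v := by
  obtain ⟨i₀, hi₀⟩ := Finite.exists_min hA.eigenvalues
  refine ⟨hA.eigenvalues i₀, ?_, (hA.eigenvectorBasis i₀).ofLp, ?_, ?_⟩
  · have hB : (A - (hA.eigenvalues i₀ : ℂ) • (1 : Matrix ι ι ℂ)).IsHermitian := by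
      refine hA.sub ?_
      rw [Matrix.IsHermitian, Matrix.conjTranspose_smul, Matrix.conjTranspose_one]
      simp
    rw [hB.posSemidef_iff_eigenvalues_nonneg]
    intro i
    have h1 := hB.mulVec_eigenvectorBasis i
    set v := (hB.eigenvectorBasis i).ofLp with hv
    have hv0 : v ≠ 0 := by
      intro h
      apply hB.eigenvectorBasis.toBasis.ne_zero i
      ext s
      simpa [hv] using congrFun h s
    have h2 : (Matrix.scalar ι ((hB.eigenvalues i + hA.eigenvalues i₀ : ℝ) : ℂ) - A) *ᵥ v = 0 := by
      rw [Matrix.sub_mulVec, Matrix.smul_mulVec, Matrix.one_mulVec, sub_eq_iff_eq_add] at h1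
      rw [Matrix.sub_mulVec, h1, Matrix.scalar_apply, ← Matrix.smul_one_eq_diagonal,
        Matrix.smul_mulVec, Matrix.one_mulVec]
      ext s
      simp
      ring
    have h3 := Matrix.exists_mulVec_eq_zero_iff.mp ⟨v, hv0, h2⟩
    rw [← Matrix.eval_charpoly, hA.charpoly_eq, Polynomial.eval_prod,
      Finset.prod_eq_zero_iff] at h3
    obtain ⟨k, -, hk⟩ := h3
    have h4 : hB.eigenvalues i + hA.eigenvalues i₀ = hA.eigenvalues k := by
      rw [Polynomial.eval_sub, Polynomial.eval_X, Polynomial.eval_C, sub_eq_zero] at hk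
      exact Complex.ofReal_injective hk
    have := hi₀ k
    simp only [Pi.zero_apply]
    linarith
  · intro h
    apply hA.eigenvectorBasis.toBasis.ne_zero i₀
    ext s
    simpa using congrFun h s
  · have := hA.mulVec_eigenvectorBasis i₀
    rw [this]
    ext s
    simp

theorem gapMat_mulVec_ofReal {n : ℕ} (hn : 1 ≤ n) (J : Axis → ℝ) (x : Config (2 * n + 1) → ℝ)
    (s : Config (2 * n + 1)) :
    (gapMat n (fun a => (J a : ℂ)) *ᵥ fun t => (x t : ℂ)) s = gapOp n J x s := by
  rw [gapMat_mulVec hn]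
  have : gapOp n J (fun _ => 0) s = 0 := by simp [gapOp]
  simp [this]

theorem isEigen_re_im {n : ℕ} (hn : 1 ≤ n) {J : Axis → ℝ} {E : ℝ} {Ψ : Config (2 * n + 1) → ℂ}
    (h : gapMat n (fun a => (J a : ℂ)) *ᵥ Ψ = (E : ℂ) • Ψ) :
    IsEigen n J E (fun s => (Ψ s).re) ∧ IsEigen n J E (fun s => (Ψ s).im) := by
  constructor <;> intro s <;> have h1 := congrFun h s <;>
    rw [gapMat_mulVec hn, Complex.ext_iff] at h1
  · simpa using h1.1
  · simpa using h1.2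

/-- A vector on which a positive semidefinite form vanishes lies in its kernel. -/
theorem isLowest_of_posSemidef {n : ℕ} (hn : 1 ≤ n) {J : Axis → ℝ} {E : ℝ}
    (h : (gapMat n (fun a => (J a : ℂ)) - (E : ℂ) • 1).PosSemidef) : IsLowest n J E := by
  intro x hx
  set v : Config (2 * n + 1) → ℂ := fun s => (x s : ℂ) with hv
  have h1 : (gapMat n (fun a => (J a : ℂ)) - (E : ℂ) • 1) *ᵥ v =
      fun s => ((gapOp n J x s - E * x s : ℝ) : ℂ) := by
    funext s
    rw [Matrix.sub_mulVec, Pi.sub_apply, hv, gapMat_mulVec_ofReal hn, Matrix.smul_mulVec,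
      Matrix.one_mulVec]
    simp
  have h2 : star v ⬝ᵥ ((gapMat n (fun a => (J a : ℂ)) - (E : ℂ) • 1) *ᵥ v) =
      ((∑ s, x s * gapOp n J x s - E * ∑ s, x s * x s : ℝ) : ℂ) := by
    rw [h1, dotProduct, Finset.mul_sum, ← Finset.sum_sub_distrib, Complex.ofReal_sum]
    refine Finset.sum_congr rfl fun s _ => ?_
    simp [hv]
    ring
  have h3 := h.dotProduct_mulVec_nonneg v
  rw [h2] at h3
  have h4 : (0 : ℝ) ≤ ∑ s, x s * gapOp n J x s - E * ∑ s, x s * x s := by exact_mod_cast h3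
  have h5 := (h.dotProduct_mulVec_zero_iff v).mp (by
    rw [h2, le_antisymm (by linarith) h4, Complex.ofReal_zero])
  intro s
  have h6 := congrFun h5 s
  rw [h1, Pi.zero_apply, Complex.ofReal_eq_zero] at h6
  linarith

theorem gapMat_posSemidef_of_isCoupling {n : ℕ} (hn : 1 ≤ n) {J : Axis → ℝ} {lam ζ : ℝ}
    (hlam : 0 < lam) (hζ : 0 < ζ) (hJ : IsCoupling J lam ζ) :
    (gapMat n (fun a => (J a : ℂ))).PosSemidef ∧ IsLowest n J 0 ∧
      ∃ x : Config (2 * n + 1) → ℝ, x ≠ 0 ∧ IsEigen n J 0 x := by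
  obtain ⟨E, hpos, v, hv0, hv⟩ := exists_lowest_eigenvector (gapMat_isHermitian n J)
  have hlow := isLowest_of_posSemidef hn hpos
  have hx : ∃ x : Config (2 * n + 1) → ℝ, x ≠ 0 ∧ IsEigen n J E x := by
    obtain ⟨h1, h2⟩ := isEigen_re_im hn hv
    by_cases h : (fun s => (v s).re) = 0
    · refine ⟨_, fun h' => hv0 ?_, h2⟩
      funext s
      exact Complex.ext (congrFun h s) (congrFun h' s)
    · exact ⟨_, h, h1⟩
  obtain ⟨x, hx0, hx⟩ := hx
  obtain rfl : E = 0 := lowest_eq_zero hn hlam hζ hJ hlow hx hx0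
  exact ⟨by simpa using hpos, hlow, x, hx0, hx⟩

theorem fin_ne_add_one {n : ℕ} (hn : 1 ≤ n) (j : Fin (2 * n + 1)) : j ≠ j + 1 := by
  intro h
  have h1 : (1 : Fin (2 * n + 1)) = 0 := by simpa using h.symm
  have := congrArg Fin.val h1
  rw [Fin.coe_ofNat_eq_mod, Nat.mod_eq_of_lt (by omega)] at this
  simp at this

theorem IsEigen.parity {n : ℕ} (hn : 1 ≤ n) {J : Axis → ℝ} {E : ℝ}
    {x : Config (2 * n + 1) → ℝ} (hx : IsEigen n J E x) :
    IsEigen n J E (fun s => XYZChain.parity s * x s) := by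
  intro s
  have h : gapOp n J (fun s => XYZChain.parity s * x s) s = XYZChain.parity s * gapOp n J x s := by
    simp only [gapOp, parity_flipTwo (fin_ne_add_one hn _), Finset.mul_sum]
    exact Finset.sum_congr rfl fun j _ => by ring
  rw [h, hx]
  ring

/-- A zero mode supported on one parity class. -/
theorem exists_even_zeroMode {n : ℕ} (hn : 1 ≤ n) {J : Axis → ℝ} {E : ℝ} (h1 : J .y < J .x)
    (h2 : 0 < J .x + J .y) (hE : IsLowest n J E)
    (hx : ∃ x : Config (2 * n + 1) → ℝ, x ≠ 0 ∧ IsEigen n J E x) :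
    ∃ u : Config (2 * n + 1) → ℝ, IsEigen n J E u ∧ u (allDown _) = 1 ∧
      ∀ s, parity s = 1 → u s = 0 := by
  obtain ⟨x, hx, hx0⟩ : ∃ x : Config (2 * n + 1) → ℝ, IsEigen n J E x ∧ x (allDown _) ≠ 0 := by
    obtain ⟨x, hx0, hx⟩ := hx
    by_cases h : x (allDown _) = 0
    · exact ⟨_, hx.flipAll, fun h' => hx0 (hx.eq_zero hE h1 h2 h h')⟩
    · exact ⟨x, hx, h⟩
  refine ⟨_, hx.lin (hx.parity hn) (1 / (2 * x (allDown _))) (-(1 / (2 * x (allDown _)))), ?_, ?_⟩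
  · simp only [parity_allDown]
    field_simp
    norm_num
  · intro s hs
    simp only [hs]
    ring

theorem IsEigen.eq_combination {n : ℕ} {J : Axis → ℝ} {E : ℝ} (h1 : J .y < J .x)
    (h2 : 0 < J .x + J .y) (hE : IsLowest n J E) {u y : Config (2 * n + 1) → ℝ}
    (hu : IsEigen n J E u) (hu1 : u (allDown _) = 1) (hu0 : ∀ s, XYZChain.parity s = 1 → u s = 0)
    (hy : IsEigen n J E y) (s : Config (2 * n + 1)) :
    y s = y (allDown _) * u s + y (XYZChain.flipAll (allDown _)) * u (XYZChain.flipAll s) := by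
  have hup : u (XYZChain.flipAll (allDown _)) = 0 :=
    hu0 _ (by rw [parity_flipAll, parity_allDown, neg_neg])
  have h := ((hy.lin hu 1 (-y (allDown _))).lin hu.flipAll 1
    (-y (XYZChain.flipAll (allDown _)))).eq_zero hE h1 h2
    (by simp only [hup, hu1]; ring) (by simp only [flipAll_flipAll, hup, hu1]; ring)
  have := congrFun h s
  simp only [Pi.zero_apply] at this
  linarith

/-- The coefficient in the action of `pairMat` on basis configurations. -/
def pairCoeff {n : ℕ} (a : Axis) (j : Fin (2 * n + 1)) (s : Config (2 * n + 1)) : ℝ :=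
  match a with
  | .x => 1
  | .y => -(spin (s j) * spin (s (j + 1)))
  | .z => spin (s j) * spin (s (j + 1))

/-- The configuration that `pairMat` maps to the given one. -/
def pairTarget {n : ℕ} (a : Axis) (j : Fin (2 * n + 1)) (s : Config (2 * n + 1)) :
    Config (2 * n + 1) :=
  match a with
  | .z => s
  | _ => flipTwo j (j + 1) s

theorem pairMat_mulVec_apply {n : ℕ} (hn : 1 ≤ n) (a : Axis) (j : Fin (2 * n + 1))
    (Ψ : Config (2 * n + 1) → ℂ) (s : Config (2 * n + 1)) :
    (pairMat n a j *ᵥ Ψ) s = pairCoeff a j s * Ψ (pairTarget a j s) := by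
  obtain ⟨h1, h2, h3⟩ := pairMat_mulVec hn j Ψ s
  cases a
  · rw [h1]; simp [pairCoeff, pairTarget]
  · rw [h2]; simp [pairCoeff, pairTarget]
  · rw [h3]; simp [pairCoeff, pairTarget]

theorem parity_pairTarget {n : ℕ} (hn : 1 ≤ n) (a : Axis) (j : Fin (2 * n + 1))
    (s : Config (2 * n + 1)) : parity (pairTarget a j s) = parity s := by
  cases a <;> simp [pairTarget, parity_flipTwo (fin_ne_add_one hn j)]

theorem pairCoeff_flipAll {n : ℕ} (a : Axis) (j : Fin (2 * n + 1)) (s : Config (2 * n + 1)) :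
    pairCoeff a j (flipAll s) = pairCoeff a j s := by
  cases a <;> simp [pairCoeff, flipAll, spin_add_one]

theorem pairTarget_flipAll {n : ℕ} (a : Axis) (j : Fin (2 * n + 1)) (s : Config (2 * n + 1)) :
    pairTarget a j (flipAll s) = flipAll (pairTarget a j s) := by
  have h : flipTwo j (j + 1) (flipAll s) = flipAll (flipTwo j (j + 1) s) := by
    funext l
    by_cases hl : l = j ∨ l = j + 1 <;> simp [flipTwo, flipAll, hl]
  cases a <;> simp [pairTarget, h]

theorem pairCoeff_shift {n : ℕ} (a : Axis) (j : Fin (2 * n + 1)) (s : Config (2 * n + 1)) :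
    pairCoeff a j (shift s) = pairCoeff a (j + 1) s := by
  cases a <;> simp [pairCoeff, shift]

theorem pairTarget_shift {n : ℕ} (a : Axis) (j : Fin (2 * n + 1)) (s : Config (2 * n + 1)) :
    pairTarget a j (shift s) = shift (pairTarget a (j + 1) s) := by
  have h : flipTwo j (j + 1) (shift s) = shift (flipTwo (j + 1) (j + 1 + 1) s) := by
    funext l
    simp [flipTwo, shift]
  cases a <;> simp [pairTarget, h]

theorem shift_bijective {n : ℕ} : Function.Bijective (shift (n := n)) :=
  (Equiv.arrowCongr (Equiv.subRight (1 : Fin (2 * n + 1))) (Equiv.refl (Fin 2))).bijective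

/-- The eigenspace is spanned by `u` and its global flip, supported on opposite parity classes.
Cross terms vanish because pair operators preserve parity; the diagonal terms agree by flip symmetry
and are independent of `j` by shift invariance. -/
theorem exists_correlation {n : ℕ} (hn : 1 ≤ n) {J : Axis → ℝ} {E : ℝ} (h1 : J .y < J .x)
    (h2 : 0 < J .x + J .y) (hE : IsLowest n J E) {u : Config (2 * n + 1) → ℝ}
    (hu : IsEigen n J E u) (hu1 : u (allDown _) = 1) (hu0 : ∀ s, parity s = 1 → u s = 0)
    (a : Axis) :
    ∃ c : ℝ, ∀ Ψ : Config (2 * n + 1) → ℂ,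
      gapMat n (fun a => (J a : ℂ)) *ᵥ Ψ = (E : ℂ) • Ψ → ∀ j,
        star Ψ ⬝ᵥ (pairMat n a j *ᵥ Ψ) = c * (star Ψ ⬝ᵥ Ψ) := by
  set f : Fin (2 * n + 1) → ℝ := fun j => ∑ s, u s * (pairCoeff a j s * u (pairTarget a j s))
    with hf
  have hfj : ∀ j, f j = f 0 := by
    have hstep : ∀ j, f (j + 1) = f j := by
      intro j
      simp only [hf]
      rw [← Function.Bijective.sum_comp shift_bijective
        (fun s => u s * (pairCoeff a j s * u (pairTarget a j s)))]
      refine Finset.sum_congr rfl fun s _ => ?_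
      rw [pairCoeff_shift, pairTarget_shift, hu.shift_eq hE h1 h2, hu.shift_eq hE h1 h2]
    intro j
    induction j using Fin.induction with
    | zero => rfl
    | succ i ih => rw [← ih, ← Fin.coeSucc_eq_succ, hstep]
  set N : ℝ := ∑ s, u s * u s with hN
  have hN0 : N ≠ 0 := by
    have h3 : 0 < N := Finset.sum_pos' (fun s _ => mul_self_nonneg _)
      ⟨allDown _, Finset.mem_univ _, by rw [hu1]; norm_num⟩
    exact h3.ne'
  have hflip : ∀ j, ∑ s, u (flipAll s) * (pairCoeff a j s * u (flipAll (pairTarget a j s))) =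
      f j := by
    intro j
    simp only [hf]
    rw [← Function.Bijective.sum_comp (Function.Involutive.bijective flipAll_flipAll)
        (fun s => u s * (pairCoeff a j s * u (pairTarget a j s)))]
    exact Finset.sum_congr rfl fun s _ => by rw [pairCoeff_flipAll, pairTarget_flipAll]
  have hNflip : ∑ s, u (flipAll s) * u (flipAll s) = N :=
    Function.Bijective.sum_comp (Function.Involutive.bijective flipAll_flipAll)
      (fun s : Config (2 * n + 1) => u s * u s)
  have hmix : ∀ s t : Config (2 * n + 1), parity t = parity s → u s * u (flipAll t) = 0 := by
    intro s t h
    rcases parity_eq s with hs | hs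
    · rw [hu0 s hs, zero_mul]
    · rw [hu0 (flipAll t) (by rw [parity_flipAll, h, hs, neg_neg]), mul_zero]
  refine ⟨f 0 / N, fun Ψ hΨ j => ?_⟩
  obtain ⟨hre, him⟩ := isEigen_re_im hn hΨ
  obtain ⟨α, β, hαβ⟩ : ∃ α β : ℂ, ∀ s, Ψ s = α * u s + β * u (flipAll s) := by
    refine ⟨Ψ (allDown _), Ψ (flipAll (allDown _)), fun s => ?_⟩
    apply Complex.ext
    · simpa using hu.eq_combination h1 h2 hE hu1 hu0 hre s
    · simpa using hu.eq_combination h1 h2 hE hu1 hu0 him s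
  have hA : star Ψ ⬝ᵥ (pairMat n a j *ᵥ Ψ) =
      (star α * α) * (f j : ℂ) + (star β * β) * (f j : ℂ) := by
    rw [dotProduct]
    nth_rewrite 2 [← hflip j]
    simp only [hf]
    rw [Complex.ofReal_sum, Complex.ofReal_sum, Finset.mul_sum, Finset.mul_sum,
      ← Finset.sum_add_distrib]
    refine Finset.sum_congr rfl fun s _ => ?_
    rw [pairMat_mulVec_apply hn, Pi.star_apply, hαβ, hαβ]
    have m1 := congrArg ((↑) : ℝ → ℂ) (hmix s _ (parity_pairTarget hn a j s))
    have m2 := congrArg ((↑) : ℝ → ℂ) (hmix _ s (parity_pairTarget hn a j s).symm)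
    push_cast at m1 m2 ⊢
    simp only [star_add, star_mul', RCLike.star_def, Complex.conj_ofReal]
    linear_combination (starRingEnd ℂ α * β * pairCoeff a j s) * m1 +
      (starRingEnd ℂ β * α * pairCoeff a j s) * m2
  have hB : star Ψ ⬝ᵥ Ψ = (star α * α) * (N : ℂ) + (star β * β) * (N : ℂ) := by
    rw [dotProduct]
    nth_rewrite 2 [← hNflip]
    rw [hN, Complex.ofReal_sum, Complex.ofReal_sum, Finset.mul_sum, Finset.mul_sum,
      ← Finset.sum_add_distrib]
    refine Finset.sum_congr rfl fun s _ => ?_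
    rw [Pi.star_apply, hαβ]
    have m1 := congrArg ((↑) : ℝ → ℂ) (hmix s s rfl)
    push_cast at m1 ⊢
    simp only [star_add, star_mul', RCLike.star_def, Complex.conj_ofReal]
    linear_combination (starRingEnd ℂ α * β + starRingEnd ℂ β * α) * m1
  have hN0' : (N : ℂ) ≠ 0 := by exact_mod_cast hN0
  rw [hA, hB, hfj]
  push_cast
  field_simp

/-- For a Hermitian matrix, the algebraic multiplicity of the eigenvalue zero equals the dimension
of the kernel. -/
theorem charpoly_eq_of_finrank_ker {ι : Type*} [Fintype ι] [DecidableEq ι] {A : Matrix ι ι ℂ}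
    (hA : A.IsHermitian) {d : ℕ} (hd : Module.finrank ℂ (LinearMap.ker A.mulVecLin) = d) :
    ∃ q : ℂ[X], A.charpoly = X ^ d * q ∧ q.coeff 0 ≠ 0 := by
  have h1 := LinearMap.finrank_range_add_finrank_ker A.mulVecLin
  rw [hd, ← Matrix.rank, hA.rank_eq_card_non_zero_eigs, Module.finrank_fintype_fun_eq_card] at h1
  have h2 : (Finset.univ.filter fun i => hA.eigenvalues i = 0).card = d := by
    have h3 := Finset.card_filter_add_card_filter_not (s := (Finset.univ : Finset ι))
      (fun i => hA.eigenvalues i = 0)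
    rw [Fintype.card_subtype] at h1
    rw [Finset.card_univ] at h3
    simp only [ne_eq] at h1
    omega
  refine ⟨∏ i with ¬ hA.eigenvalues i = 0, (X - C (hA.eigenvalues i : ℂ)), ?_, ?_⟩
  · rw [hA.charpoly_eq, ← Finset.prod_filter_mul_prod_filter_not Finset.univ
      (fun i => hA.eigenvalues i = 0)]
    congr 1
    rw [← h2, ← Finset.prod_const]
    refine Finset.prod_congr rfl fun i hi => ?_
    rw [(Finset.mem_filter.mp hi).2]
    simp
  · rw [Polynomial.coeff_zero_prod]
    refine Finset.prod_ne_zero_iff.mpr fun i hi => ?_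
    simpa using (Finset.mem_filter.mp hi).2

/-- The properties of the shifted Hamiltonian on the supersymmetric cone: positivity, a
two-dimensional kernel, and correlations that take the same value on all its vectors. -/
structure IsGapped (n : ℕ) (J : Axis → ℝ) : Prop where
  posSemidef : (gapMat n fun a => (J a : ℂ)).PosSemidef
  charpoly : ∃ q : ℂ[X], (gapMat n fun a => (J a : ℂ)).charpoly = X ^ 2 * q ∧ q.coeff 0 ≠ 0
  correlation : ∃ c : Axis → ℝ, ∀ Ψ : Config (2 * n + 1) → ℂ,
    gapMat n (fun a => (J a : ℂ)) *ᵥ Ψ = 0 → ∀ a j,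
      star Ψ ⬝ᵥ (pairMat n a j *ᵥ Ψ) = c a * (star Ψ ⬝ᵥ Ψ)

theorem isGapped_of_isCoupling {n : ℕ} (hn : 1 ≤ n) {J : Axis → ℝ} {lam ζ : ℝ}
    (hlam : 0 < lam) (hζ : 0 < ζ) (hJ : IsCoupling J lam ζ) : IsGapped n J := by
  have h1 : J .y < J .x := by
    rw [hJ.1, hJ.2.1]
    nlinarith
  have h2 : 0 < J .x + J .y := by
    rw [hJ.1, hJ.2.1]
    nlinarith
  obtain ⟨hpos, hE, hx⟩ := gapMat_posSemidef_of_isCoupling hn hlam hζ hJ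
  obtain ⟨u, hu, hu1, hu0⟩ := exists_even_zeroMode hn h1 h2 hE hx
  have hup : u (flipAll (allDown _)) = 0 :=
    hu0 _ (by rw [parity_flipAll, parity_allDown, neg_neg])
  refine ⟨hpos, ?_, ?_⟩
  · apply charpoly_eq_of_finrank_ker (gapMat_isHermitian n J)
    set b : Fin 2 → Config (2 * n + 1) → ℂ :=
      ![fun s => (u s : ℂ), fun s => (u (flipAll s) : ℂ)] with hb
    have hli : LinearIndependent ℂ b := by
      rw [hb, LinearIndependent.pair_iff]
      intro p q hpq
      have e1 := congrFun hpq (allDown _)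
      have e2 := congrFun hpq (flipAll (allDown _))
      simp only [Pi.add_apply, Pi.smul_apply, flipAll_flipAll, hu1, hup] at e1 e2
      exact ⟨by simpa using e1, by simpa using e2⟩
    have hspan : LinearMap.ker (gapMat n fun a => (J a : ℂ)).mulVecLin =
        Submodule.span ℂ (Set.range b) := by
      apply le_antisymm
      · intro Ψ hΨ
        rw [LinearMap.mem_ker, Matrix.mulVecLin_apply] at hΨ
        obtain ⟨hre, him⟩ := isEigen_re_im (E := 0) hn (by rw [hΨ]; simp)
        have : Ψ = Ψ (allDown _) • b 0 + Ψ (flipAll (allDown _)) • b 1 := by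
          funext s
          apply Complex.ext
          · simpa [hb] using hu.eq_combination h1 h2 hE hu1 hu0 hre s
          · simpa [hb] using hu.eq_combination h1 h2 hE hu1 hu0 him s
        rw [this]
        exact Submodule.add_mem _
          (Submodule.smul_mem _ _ (Submodule.subset_span ⟨0, rfl⟩))
          (Submodule.smul_mem _ _ (Submodule.subset_span ⟨1, rfl⟩))
      · rw [Submodule.span_le]
        have hker : ∀ y : Config (2 * n + 1) → ℝ, IsEigen n J 0 y →
            gapMat n (fun a => (J a : ℂ)) *ᵥ (fun s => (y s : ℂ)) = 0 := by
          intro y hy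
          funext s
          rw [gapMat_mulVec_ofReal hn, hy]
          simp
        rintro _ ⟨i, rfl⟩
        rw [SetLike.mem_coe, LinearMap.mem_ker, Matrix.mulVecLin_apply]
        fin_cases i
        · exact hker u hu
        · exact hker _ hu.flipAll
    rw [hspan, finrank_span_eq_card hli, Fintype.card_fin]
  · choose c hc using exists_correlation hn h1 h2 hE hu hu1 hu0
    exact ⟨c, fun Ψ hΨ a j => hc a Ψ (by rw [hΨ]; simp) j⟩

theorem swap_conj_gapMat {n : ℕ} {a b : Axis} (h : a ≠ b) (J : Axis → ℂ) :
    tensorPow _ (swapMat a b) * gapMat n (fun c => J (Equiv.swap a b c)) *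
      tensorPow _ (swapMat a b) = gapMat n J :=
  tensorPow_conj_gapMat (swapMat_mul_self h) _ (swapMat_conj_pauli h) J

/-- All three properties are invariant under the unitary involution that exchanges two axes, with
the correlations permuted accordingly. -/
theorem IsGapped.of_swap {n : ℕ} {J : Axis → ℝ} {a b : Axis} (hab : a ≠ b)
    (h : IsGapped n (fun c => J (Equiv.swap a b c))) : IsGapped n J := by
  set T := tensorPow (2 * n + 1) (swapMat a b) with hT
  have hTT : T * T = 1 := tensorPow_mul_self (swapMat_mul_self hab)
  have hTH : Tᴴ = T := tensorPow_isHermitian (swapMat_conjTranspose a b)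
  have hM := swap_conj_gapMat (n := n) hab fun c => (J c : ℂ)
  rw [← hT] at hM
  refine ⟨?_, ?_, ?_⟩
  · rw [← hM]
    nth_rewrite 2 [← hTH]
    exact h.posSemidef.mul_mul_conjTranspose_same T
  · rw [← hM, Matrix.charpoly_mul_comm, ← Matrix.mul_assoc, hTT, Matrix.one_mul]
    exact h.charpoly
  · obtain ⟨c, hc⟩ := h.correlation
    refine ⟨fun d => c (Equiv.swap a b d), fun Ψ hΨ d j => ?_⟩
    have hker : gapMat n (fun c => (J (Equiv.swap a b c) : ℂ)) *ᵥ (T *ᵥ Ψ) = 0 := by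
      rw [← hM] at hΨ
      have := congrArg (T *ᵥ ·) hΨ
      simp only [Matrix.mulVec_mulVec, Matrix.mulVec_zero] at this
      rw [← Matrix.mul_assoc, ← Matrix.mul_assoc, hTT, Matrix.one_mul] at this
      rwa [Matrix.mulVec_mulVec]
    have h1 := hc _ hker (Equiv.swap a b d) j
    have hstar : ∀ B : Matrix (Config (2 * n + 1)) (Config (2 * n + 1)) ℂ,
        star (T *ᵥ Ψ) ⬝ᵥ (B *ᵥ (T *ᵥ Ψ)) = star Ψ ⬝ᵥ ((T * B * T) *ᵥ Ψ) := by
      intro B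
      rw [Matrix.star_mulVec, hTH, ← Matrix.dotProduct_mulVec, Matrix.mulVec_mulVec,
        Matrix.mulVec_mulVec]
    have hpair : T * pairMat n (Equiv.swap a b d) j * T = pairMat n d j := by
      obtain ⟨ε, hε, hU⟩ := swapMat_conj_pauli hab (Equiv.swap a b d)
      rw [Equiv.swap_apply_self] at hU
      exact tensorPow_conj_pairMat (swapMat_mul_self hab) hε hU j
    have h2 := hstar 1
    rw [Matrix.one_mulVec, Matrix.mul_one, hTT, Matrix.one_mulVec] at h2
    rwa [hstar, hpair, h2] at h1

theorem IsSupersymmetric.swap {J : Axis → ℝ} (hJ : IsSupersymmetric J) (a b : Axis) :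
    IsSupersymmetric (fun c => J (Equiv.swap a b c)) := by
  obtain ⟨h1, h2⟩ := hJ
  cases a <;> cases b <;> simp [IsSupersymmetric, Equiv.swap_apply_def] <;>
    exact ⟨by linarith, by linarith⟩

/-- On the cone $(J_x+J_y)(J_x+J_y+J_z)=J_x^2+J_xJ_y+J_y^2$, a positive form. -/
theorem IsSupersymmetric.add_pos {J : Axis → ℝ} (hJ : IsSupersymmetric J)
    (h0 : J .x ≠ 0) : 0 < J .x + J .y := by
  obtain ⟨h1, h2⟩ := hJ
  have h3 : 0 < (J .x + J .y) * (J .x + J .y + J .z) := by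
    have : 0 < J .x ^ 2 := by positivity
    nlinarith [sq_nonneg (J .x + 2 * J .y)]
  exact pos_of_mul_pos_left h3 h2.le

theorem IsSupersymmetric.exists_isCoupling {J : Axis → ℝ} (hJ : IsSupersymmetric J)
    (h : 0 < J .x + J .y) :
    IsCoupling J ((J .x + J .y) / 2) ((J .x - J .y) / (J .x + J .y)) := by
  obtain ⟨h1, h2⟩ := hJ
  refine ⟨?_, ?_, ?_⟩
  · field_simp
    ring
  · field_simp
    ring
  · field_simp
    linear_combination 4 * h1

theorem isGapped_of_lt {n : ℕ} (hn : 1 ≤ n) {J : Axis → ℝ} (hJ : IsSupersymmetric J)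
    (h0 : J .x ≠ 0) (h : J .y < J .x) : IsGapped n J := by
  have h1 := hJ.add_pos h0
  exact isGapped_of_isCoupling hn (by linarith) (div_pos (by linarith) h1)
    (hJ.exists_isCoupling h1)

theorem IsSupersymmetric.isGapped {n : ℕ} (hn : 1 ≤ n) {J : Axis → ℝ} (hJ : IsSupersymmetric J)
    (h0 : ∀ a, J a ≠ 0) : IsGapped n J := by
  rcases lt_trichotomy (J .y) (J .x) with h | h | h
  · exact isGapped_of_lt hn hJ (h0 .x) h
  -- At $J_x=J_y$ the parameter $\zeta$ is zero and the positive weights degenerate. There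
  -- $J_x=-2J_z>0$, so exchanging $y$ and $z$ restores the strict inequality.
  · refine IsGapped.of_swap (a := .y) (b := .z) (by nofun)
      (isGapped_of_lt hn (hJ.swap .y .z) (h0 _) ?_)
    have h1 : J .x * (J .x + 2 * J .z) = 0 := by
      have := hJ.1
      rw [h] at this
      linarith
    have h2 := (mul_eq_zero.mp h1).resolve_left (h0 .x)
    have h3 := hJ.2
    simp only [Equiv.swap_apply_def]
    simp
    linarith
  · exact IsGapped.of_swap (a := .x) (b := .y) (by nofun)
      (isGapped_of_lt hn (hJ.swap .x .y) (h0 _) (by simpa using h))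

/-! ### Variation along the supersymmetric cone -/

theorem IsGapped.exists_ne_zero {n : ℕ} {J : Axis → ℝ} (h : IsGapped n J) :
    ∃ Ψ : Config (2 * n + 1) → ℂ, Ψ ≠ 0 ∧ gapMat n (fun a => (J a : ℂ)) *ᵥ Ψ = 0 := by
  rw [Matrix.exists_mulVec_eq_zero_iff]
  obtain ⟨q, hq, -⟩ := h.charpoly
  have h1 := Matrix.eval_charpoly (gapMat n fun a => (J a : ℂ)) 0
  rw [hq] at h1
  simpa [Matrix.det_neg] using h1.symm

theorem star_dotProduct_gapMat {n : ℕ} {c : Axis → ℝ} {Ψ : Config (2 * n + 1) → ℂ}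
    (hc : ∀ a j, star Ψ ⬝ᵥ (pairMat n a j *ᵥ Ψ) = c a * (star Ψ ⬝ᵥ Ψ)) (J : Axis → ℝ) :
    star Ψ ⬝ᵥ (gapMat n (fun a => (J a : ℂ)) *ᵥ Ψ) =
      ((1 / 2 * ((2 * n + 1 : ℕ) * ∑ a, J a * (1 - c a)) : ℝ) : ℂ) * (star Ψ ⬝ᵥ Ψ) := by
  simp only [gapMat, Matrix.smul_mulVec, Matrix.sum_mulVec, Matrix.sub_mulVec,
    Matrix.one_mulVec, dotProduct_smul, dotProduct_sum, dotProduct_sub, hc, smul_eq_mul]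
  rw [Finset.sum_const, Finset.card_univ, Fintype.card_fin, nsmul_eq_mul]
  push_cast
  rw [mul_assoc, mul_assoc, Finset.sum_mul]
  congr 2
  exact Finset.sum_congr rfl fun a _ => by ring

/-- First-order variation of the ground-state energy along the supersymmetric cone. -/
theorem correlation_variation {n : ℕ} (hn : 1 ≤ n) {J : Axis → ℝ} (hJ : IsSupersymmetric J)
    (h0 : ∀ a, J a ≠ 0) {c : Axis → ℝ}
    (hc : ∀ Ψ : Config (2 * n + 1) → ℂ, gapMat n (fun a => (J a : ℂ)) *ᵥ Ψ = 0 → ∀ a j,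
      star Ψ ⬝ᵥ (pairMat n a j *ᵥ Ψ) = c a * (star Ψ ⬝ᵥ Ψ)) :
    ∑ a, J a * (1 - c a) = 0 ∧ ∀ J' : Axis → ℝ, IsSupersymmetric J' → (∀ a, J' a ≠ 0) →
      0 ≤ ∑ a, J' a * (1 - c a) := by
  obtain ⟨Ψ, hΨ0, hΨ⟩ := (hJ.isGapped hn h0).exists_ne_zero
  have hpos : 0 < star Ψ ⬝ᵥ Ψ := dotProduct_star_self_pos_iff.mpr hΨ0
  have hL : (0 : ℝ) < (2 * n + 1 : ℕ) := by positivity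
  constructor
  · have h1 := star_dotProduct_gapMat (hc Ψ hΨ) J
    rw [hΨ, dotProduct_zero, eq_comm, mul_eq_zero, Complex.ofReal_eq_zero] at h1
    have h2 := h1.resolve_right hpos.ne'
    have h3 := (mul_eq_zero.mp h2).resolve_left (by norm_num)
    exact (mul_eq_zero.mp h3).resolve_left hL.ne'
  · intro J' hJ' h0'
    -- The zero mode at `J` serves as a trial vector for the positive operator at `J'`.
    have h1 := (hJ'.isGapped hn h0').posSemidef.dotProduct_mulVec_nonneg Ψ
    rw [star_dotProduct_gapMat (hc Ψ hΨ) J'] at h1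
    have h2 : (0 : ℂ) ≤ ((1 / 2 * ((2 * n + 1 : ℕ) * ∑ a, J' a * (1 - c a)) : ℝ) : ℂ) :=
      le_of_mul_le_mul_right (by rwa [zero_mul]) hpos
    have h3 : (0 : ℝ) ≤ 1 / 2 * ((2 * n + 1 : ℕ) * ∑ a, J' a * (1 - c a)) := by
      exact_mod_cast h2
    have h4 := nonneg_of_mul_nonneg_right h3 (by norm_num)
    exact nonneg_of_mul_nonneg_right h4 hL

/-- Along the cone the trial energy is nonnegative and vanishes at `J`, so its derivative vanishes
as well. The two resulting equations fix the ratios of the numbers `1 - c a`; the sum of the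
correlations sets their common scale. -/
theorem correlation_eq {n : ℕ} (hn : 1 ≤ n) {J : Axis → ℝ} (hJ : IsSupersymmetric J)
    (h0 : ∀ a, J a ≠ 0) {c : Axis → ℝ}
    (hc : ∀ Ψ : Config (2 * n + 1) → ℂ, gapMat n (fun a => (J a : ℂ)) *ᵥ Ψ = 0 → ∀ a j,
      star Ψ ⬝ᵥ (pairMat n a j *ᵥ Ψ) = c a * (star Ψ ⬝ᵥ Ψ)) (a : Axis) :
    c a = 1 + J .x * J .y * J .z / (J a ^ 2 * (J .x + J .y + J .z)) *
      ((3 - ∑ b, c b) / 2) := by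
  obtain ⟨hzero, hvar⟩ := correlation_variation hn hJ h0 hc
  have hs := hJ.add_pos (h0 .x)
  have hcoup := hJ.exists_isCoupling hs
  set ζ := (J .x - J .y) / (J .x + J .y) with hζ
  set lam := (J .x + J .y) / 2 with hlam
  have hlam0 : 0 < lam := by linarith
  obtain ⟨hx, hy, hz⟩ := hcoup
  have hζ1 : 1 + ζ ≠ 0 := fun h => h0 .x (by rw [hx, h, mul_zero])
  have hζ2 : 1 - ζ ≠ 0 := fun h => h0 .y (by rw [hy, h, mul_zero])
  rw [sum_axis] at hzero
  set X := 1 - c .x with hX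
  set Y := 1 - c .y with hY
  set W := 1 - c .z with hW
  -- Trial energy, up to a positive factor, on the slice `lam = 1` of the cone. The values $t=\pm1$,
  -- where a coupling vanishes, are excluded; they differ from `ζ`, so a local minimum suffices.
  set g : ℝ → ℝ := fun t => (1 + t) * X + (1 - t) * Y + (t ^ 2 - 1) / 2 * W with hg
  have hg0 : g ζ = 0 := by
    have : lam * g ζ = 0 := by
      rw [← hzero, hx, hy, hz]
      ring
    exact (mul_eq_zero.mp this).resolve_left hlam0.ne'
  have hgpos : ∀ t, 1 + t ≠ 0 → 1 - t ≠ 0 → 0 ≤ g t := by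
    intro t ht1 ht2
    let J' : Axis → ℝ := fun b => match b with
      | .x => 1 + t
      | .y => 1 - t
      | .z => (t ^ 2 - 1) / 2
    have h := hvar J' ⟨by simp only [J']; ring, by simp only [J']; nlinarith [sq_nonneg t]⟩ ?_
    · rwa [sum_axis] at h
    · intro b
      cases b
      · exact ht1
      · exact ht2
      · have : (t ^ 2 - 1) / 2 = -((1 + t) * (1 - t)) / 2 := by ring
        simp only [J', this]
        exact div_ne_zero (neg_ne_zero.mpr (mul_ne_zero ht1 ht2)) two_ne_zero
  have hmin : IsLocalMin g ζ := by
    have e1 : ∀ᶠ t in nhds ζ, 1 + t ≠ 0 :=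
      (continuous_const.add continuous_id).continuousAt.eventually_ne hζ1
    have e2 : ∀ᶠ t in nhds ζ, 1 - t ≠ 0 :=
      (continuous_const.sub continuous_id).continuousAt.eventually_ne hζ2
    filter_upwards [e1, e2] with t ht1 ht2
    rw [hg0]
    exact hgpos t ht1 ht2
  have hderiv : HasDerivAt g (X - Y + ζ * W) ζ := by
    have h1 : HasDerivAt (fun t : ℝ => (1 + t) * X) (1 * X) ζ :=
      ((hasDerivAt_id ζ).const_add 1).mul_const X
    have h2 : HasDerivAt (fun t : ℝ => (1 - t) * Y) (-1 * Y) ζ :=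
      ((hasDerivAt_id ζ).const_sub 1).mul_const Y
    have h3 : HasDerivAt (fun t : ℝ => (t ^ 2 - 1) / 2 * W) ((2 * ζ) / 2 * W) ζ := by
      have := (((hasDerivAt_pow 2 ζ).sub_const 1).div_const 2).mul_const W
      simpa using this
    have h4 : HasDerivAt g (1 * X + -1 * Y + (2 * ζ) / 2 * W) ζ := (h1.add h2).add h3
    exact h4.congr_deriv (by ring)
  have hd := hmin.hasDerivAt_eq_zero hderiv
  have hXW : X = (1 - ζ) ^ 2 / 4 * W := by
    simp only [hg] at hg0
    linear_combination 1 / 2 * hg0 + (1 - ζ) / 2 * hd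
  have hYW : Y = (1 + ζ) ^ 2 / 4 * W := by
    simp only [hg] at hg0
    linear_combination 1 / 2 * hg0 + (-1 - ζ) / 2 * hd
  have hζ3 : ζ ^ 2 + 3 ≠ 0 := by positivity
  have hS : J .x + J .y + J .z = lam * ((ζ ^ 2 + 3) / 2) := by
    rw [hx, hy, hz]
    ring
  have hE : J .x * J .y * J .z = -(lam ^ 3 * ((1 - ζ) ^ 2 * (1 + ζ) ^ 2) / 2) := by
    rw [hx, hy, hz]
    ring
  have hκ : (3 - ∑ b, c b) / 2 = W * (ζ ^ 2 + 3) / 4 := by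
    rw [sum_axis]
    linear_combination (hXW + hYW - hX - hY - hW) / 2
  have hz' : J .z = -(lam * ((1 - ζ) * (1 + ζ)) / 2) := by
    rw [hz]
    ring
  rw [hS, hE, hκ]
  cases a
  · rw [hx]
    field_simp
    linear_combination -4 * hXW + 4 * hX
  · rw [hy]
    field_simp
    linear_combination -4 * hYW + 4 * hY
  · rw [hz']
    field_simp
    linear_combination hW

/-! ### Kernel projection and symmetric polynomials -/

/-- A multiple of the projection onto the kernel of a Hermitian matrix with two-dimensional
kernel. -/
noncomputable def kerPoly {R : Type*} [CommRing R] {ι : Type*} [Fintype ι] [DecidableEq ι]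
    (A : Matrix ι ι R) : Matrix ι ι R :=
  aeval A A.charpoly.divX.divX

theorem divX_divX_X_sq_mul {R : Type*} [CommRing R] (q : R[X]) : (X ^ 2 * q).divX.divX = q := by
  ext k
  rw [coeff_divX, coeff_divX, pow_two, mul_assoc, coeff_X_mul, coeff_X_mul]

theorem kerPoly_map {R S : Type*} [CommRing R] [CommRing S] {ι : Type*} [Fintype ι]
    [DecidableEq ι] (f : R →+* S) (A : Matrix ι ι R) : (kerPoly A).map f = kerPoly (A.map f) := by
  have h1 : (A.map f).charpoly.divX.divX = A.charpoly.divX.divX.map f := by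
    ext k
    rw [Matrix.charpoly_map]
    simp [coeff_divX]
  rw [kerPoly, kerPoly, h1]
  refine Polynomial.map_aeval_eq_aeval_map (φ := f) (ψ := f.mapMatrix) ?_ _ A
  ext r i j
  by_cases h : i = j <;> simp [Matrix.algebraMap_matrix_apply, h]

theorem kerPoly_conj {R : Type*} [CommRing R] {ι : Type*} [Fintype ι] [DecidableEq ι]
    {T : Matrix ι ι R} (hT : T * T = 1) (A : Matrix ι ι R) :
    kerPoly (T * A * T) = T * kerPoly A * T := by
  have hc : (T * A * T).charpoly = A.charpoly := by
    rw [Matrix.charpoly_mul_comm, ← Matrix.mul_assoc, hT, Matrix.one_mul]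
  have hpow : ∀ k : ℕ, (T * A * T) ^ k = T * A ^ k * T := by
    intro k
    induction k with
    | zero => simp [hT]
    | succ k ih =>
      calc (T * A * T) ^ (k + 1) = T * A ^ k * (T * T) * A * T := by
            rw [pow_succ, ih]
            simp only [Matrix.mul_assoc]
        _ = _ := by
            rw [hT, Matrix.mul_one, pow_succ]
            simp only [Matrix.mul_assoc]
  rw [kerPoly, kerPoly, hc]
  generalize A.charpoly.divX.divX = q
  induction q using Polynomial.induction_on' with
  | add p q hp hq => rw [map_add, map_add, hp, hq, Matrix.mul_add, Matrix.add_mul]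
  | monomial k a =>
    rw [aeval_monomial, aeval_monomial, hpow, ← Algebra.smul_def, ← Algebra.smul_def,
      Matrix.mul_smul, Matrix.smul_mul]

/-- Writing the characteristic polynomial as $X^2q$, the matrix $q(A)$ is $q(0)\neq0$ times the
kernel projection. On the kernel the form of `B` is the scalar `b`, so the two traces have ratio
`b`. -/
theorem trace_kerPoly_mul {ι : Type*} [Fintype ι] [DecidableEq ι] {A B : Matrix ι ι ℂ}
    (hA : A.IsHermitian) (hB : B.IsHermitian) {q : ℂ[X]} (hq : A.charpoly = X ^ 2 * q)
    (hq0 : q.coeff 0 ≠ 0) {b : ℝ} (hb : ∀ v, A *ᵥ v = 0 → star v ⬝ᵥ (B *ᵥ v) = b * (star v ⬝ᵥ v)) :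
    (kerPoly A * B).trace = b * (kerPoly A).trace ∧ (kerPoly A).trace ≠ 0 := by
  have hR : kerPoly A = aeval A q := by rw [kerPoly, hq, divX_divX_X_sq_mul]
  set R := kerPoly A with hRdef
  have hAAR : A * A * R = 0 := by
    have := Matrix.aeval_self_charpoly A
    rw [hq, map_mul, map_pow, aeval_X, pow_two] at this
    rw [hR, this]
  -- Cayley–Hamilton gives only $A^2R=0$; hermiticity removes one factor of $A$.
  have hAR : A * R = 0 := by
    have h : Aᴴ * A * R = 0 := by rw [hA.eq, hAAR]
    rwa [Matrix.conjTranspose_mul_self_mul_eq_zero] at h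
  have hcomm : R * A = A * R := by
    rw [hR]
    have h : aeval A q * aeval A (X : ℂ[X]) = aeval A (X : ℂ[X]) * aeval A q := by
      rw [← map_mul, ← map_mul, mul_comm]
    rwa [aeval_X] at h
  have hARH : A * Rᴴ = 0 := by
    have := congrArg conjTranspose (hcomm.trans hAR)
    rwa [Matrix.conjTranspose_mul, hA.eq, Matrix.conjTranspose_zero] at this
  have hRmul : ∀ C : Matrix ι ι ℂ, A * C = 0 → R * C = q.coeff 0 • C := by
    intro C hC
    rw [hR]
    nth_rewrite 1 [← divX_mul_X_add q]
    rw [map_add, map_mul, aeval_X, aeval_C, Matrix.add_mul, Matrix.mul_assoc, hC, Matrix.mul_zero,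
      zero_add, ← Algebra.smul_def]
  have hRRH : R * Rᴴ = star (q.coeff 0) • R := by
    have := congrArg conjTranspose (hRmul _ hARH)
    rwa [Matrix.conjTranspose_mul, Matrix.conjTranspose_smul, Matrix.conjTranspose_conjTranspose]
      at this
  have hq0' : star (q.coeff 0) ≠ 0 := star_ne_zero.mpr hq0
  have hD : (B - (b : ℂ) • (1 : Matrix ι ι ℂ)).IsHermitian := by
    refine hB.sub ?_
    rw [Matrix.IsHermitian, Matrix.conjTranspose_smul, Matrix.conjTranspose_one]
    simp
  set D := B - (b : ℂ) • (1 : Matrix ι ι ℂ) with hDdef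
  -- The range of `R` lies in the kernel of `A`, where the form of `D` is zero; a matrix with
  -- identically zero form is zero.
  have hK : Rᴴ * D * R = 0 := by
    have hform : ∀ x, star x ⬝ᵥ ((Rᴴ * D * R) *ᵥ x) = 0 := by
      intro x
      have h1 : A *ᵥ (R *ᵥ x) = 0 := by rw [Matrix.mulVec_mulVec, hAR, Matrix.zero_mulVec]
      have h2 : star x ⬝ᵥ ((Rᴴ * D * R) *ᵥ x) = star (R *ᵥ x) ⬝ᵥ (D *ᵥ (R *ᵥ x)) := by
        rw [Matrix.star_mulVec, ← Matrix.dotProduct_mulVec, Matrix.mulVec_mulVec,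
          Matrix.mulVec_mulVec, Matrix.mul_assoc]
      rw [h2, hDdef, Matrix.sub_mulVec, dotProduct_sub, hb _ h1, Matrix.smul_mulVec,
        Matrix.one_mulVec, dotProduct_smul, smul_eq_mul, sub_self]
    have hpsd : (Rᴴ * D * R).PosSemidef := by
      refine Matrix.PosSemidef.of_dotProduct_mulVec_nonneg ?_ fun x => (hform x).ge
      rw [Matrix.IsHermitian, Matrix.conjTranspose_mul, Matrix.conjTranspose_mul, hD.eq,
        Matrix.conjTranspose_conjTranspose, Matrix.mul_assoc]
    refine Matrix.ext_of_mulVec_single fun i => ?_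
    rw [(hpsd.dotProduct_mulVec_zero_iff _).mp (hform _), Matrix.zero_mulVec]
  have hRB : R * B = R * D + (b : ℂ) • R := by
    rw [hDdef, Matrix.mul_sub, Matrix.mul_smul, Matrix.mul_one, sub_add_cancel]
  have htr : (R * D).trace = 0 := by
    have h1 := congrArg trace hK
    rw [Matrix.trace_zero, Matrix.trace_mul_comm, ← Matrix.mul_assoc, hRRH, Matrix.smul_mul,
      Matrix.trace_smul, smul_eq_mul] at h1
    exact (mul_eq_zero.mp h1).resolve_left hq0'
  refine ⟨by rw [hRB, Matrix.trace_add, htr, zero_add, Matrix.trace_smul, smul_eq_mul], ?_⟩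
  intro h
  have hR0 : R = 0 := by
    rw [← Matrix.trace_mul_conjTranspose_self_eq_zero_iff, hRRH, Matrix.trace_smul, h, smul_zero]
  have hdet : A.det = 0 := by
    have h1 := Matrix.eval_charpoly A 0
    rw [hq] at h1
    simpa [Matrix.det_neg] using h1.symm
  obtain ⟨v, hv0, hv⟩ := Matrix.exists_mulVec_eq_zero_iff.mpr hdet
  have h2 := hRmul (Matrix.of fun i _ => v i) (by
    ext i j
    exact congrFun hv i)
  rw [hR0, Matrix.zero_mul] at h2
  apply hv0
  funext i
  have h3 := congrFun (congrFun h2 i) i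
  simp only [Matrix.zero_apply, Matrix.smul_apply, Matrix.of_apply, smul_eq_mul] at h3
  exact (mul_eq_zero.mp h3.symm).resolve_left hq0

theorem exists_mvPolynomial_trace_kerPoly {n : ℕ}
    (B : Matrix (Config (2 * n + 1)) (Config (2 * n + 1)) ℂ) :
    ∃ P : MvPolynomial Axis ℂ, ∀ J : Axis → ℂ,
      MvPolynomial.eval J P = (kerPoly (gapMat n J) * B).trace := by
  set M : Matrix (Config (2 * n + 1)) (Config (2 * n + 1)) (MvPolynomial Axis ℂ) :=
    (MvPolynomial.C (1 / 2) : MvPolynomial Axis ℂ) • ∑ j, ∑ a,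
      (MvPolynomial.X a : MvPolynomial Axis ℂ) •
        (1 - (pairMat n a j).map (MvPolynomial.C : ℂ →+* MvPolynomial Axis ℂ))
    with hM
  refine ⟨(kerPoly M * B.map MvPolynomial.C).trace, fun J => ?_⟩
  have h1 : M.map (MvPolynomial.eval J) = gapMat n J := by
    ext s t
    simp only [hM, gapMat, Matrix.map_apply, Matrix.smul_apply, Matrix.sum_apply, smul_eq_mul,
      map_mul, map_sum, Matrix.sub_apply, map_sub, MvPolynomial.eval_C, MvPolynomial.eval_X,
      Matrix.one_apply, apply_ite (MvPolynomial.eval J), map_one, map_zero]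
  have h2 : (B.map MvPolynomial.C).map (MvPolynomial.eval J) = B := by
    ext s t
    simp
  rw [AddMonoidHom.map_trace (MvPolynomial.eval J), Matrix.map_mul, kerPoly_map, h1, h2]

theorem trace_kerPoly_swap {n : ℕ} {a b : Axis} (hab : a ≠ b)
    {B : Matrix (Config (2 * n + 1)) (Config (2 * n + 1)) ℂ}
    (hB : tensorPow _ (swapMat a b) * B * tensorPow _ (swapMat a b) = B) (J : Axis → ℂ) :
    (kerPoly (gapMat n fun c => J (Equiv.swap a b c)) * B).trace =
      (kerPoly (gapMat n J) * B).trace := by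
  rw [← swap_conj_gapMat hab J, kerPoly_conj (tensorPow_mul_self (swapMat_mul_self hab))]
  set T := tensorPow (2 * n + 1) (swapMat a b)
  nth_rewrite 1 [← hB]
  rw [← Matrix.mul_assoc, Matrix.trace_mul_comm]
  simp only [Matrix.mul_assoc]

/-- Axis exchanges act on `gapMat` by conjugation and fix `B`, so the polynomial giving the trace is
symmetric; the fundamental theorem on symmetric polynomials then applies. -/
theorem exists_symmetric_trace_kerPoly {n : ℕ}
    (B : Matrix (Config (2 * n + 1)) (Config (2 * n + 1)) ℂ)
    (hB : ∀ a b, a ≠ b → tensorPow _ (swapMat a b) * B * tensorPow _ (swapMat a b) = B) :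
    ∃ Q : MvPolynomial (Fin 3) ℂ, ∀ J : Axis → ℂ,
      (kerPoly (gapMat n J) * B).trace =
        MvPolynomial.eval ![J .x + J .y + J .z, J .x * J .y + J .x * J .z + J .y * J .z,
          J .x * J .y * J .z] Q := by
  obtain ⟨P, hP⟩ := exists_mvPolynomial_trace_kerPoly B
  have hsym : P.IsSymmetric := by
    intro e
    induction e using Equiv.Perm.swap_induction_on with
    | one => simp
    | swap_mul f a b hab ih =>
      rw [Equiv.Perm.coe_mul, ← MvPolynomial.rename_rename, ih]
      refine MvPolynomial.funext fun J => ?_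
      rw [MvPolynomial.eval_rename, hP, hP]
      exact trace_kerPoly_swap hab (hB a b hab) J
  obtain ⟨Q, hQ⟩ := MvPolynomial.esymmAlgHom_surjective (σ := Axis) ℂ (n := 3)
    (by decide) ⟨P, hsym⟩
  refine ⟨Q, fun J => ?_⟩
  have h1 : P = MvPolynomial.aeval (fun i : Fin 3 => MvPolynomial.esymm Axis ℂ (i + 1)) Q := by
    rw [← MvPolynomial.esymmAlgHom_apply, hQ]
  have h2 : (Finset.univ : Finset Axis).powersetCard 2 = {{.x, .y}, {.x, .z}, {.y, .z}} := by
    decide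
  have h3 : (Finset.univ : Finset Axis).powersetCard 3 = {{.x, .y, .z}} := by decide
  rw [← hP, h1, MvPolynomial.map_aeval]
  have h4 : (MvPolynomial.eval J).comp (algebraMap ℂ (MvPolynomial Axis ℂ)) = RingHom.id ℂ := by
    ext r
    simp
  rw [h4]
  change MvPolynomial.eval _ Q = _
  congr 2
  funext i
  fin_cases i
  · simp [MvPolynomial.esymm_one, sum_axis]
  · simp only [MvPolynomial.esymm, map_sum, map_prod, MvPolynomial.eval_X]
    change ∑ t ∈ (Finset.univ : Finset Axis).powersetCard 2, ∏ i ∈ t, J i = _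
    rw [h2, Finset.sum_insert (by decide), Finset.sum_insert (by decide), Finset.sum_singleton,
      Finset.prod_pair (by decide), Finset.prod_pair (by decide), Finset.prod_pair (by decide)]
    exact (add_assoc _ _ _).symm
  · simp [MvPolynomial.esymm, h3, mul_assoc]

/-- The sum of all nearest-neighbour spin correlations. -/
def pairSum (n : ℕ) : Matrix (Config (2 * n + 1)) (Config (2 * n + 1)) ℂ :=
  ∑ j, ∑ a, pairMat n a j

theorem pairSum_isHermitian (n : ℕ) : (pairSum n).IsHermitian := by
  simp only [pairSum, Matrix.IsHermitian, Matrix.conjTranspose_sum, (pairMat_isHermitian n _ _).eq]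

theorem swap_conj_pairSum (n : ℕ) {a b : Axis} (hab : a ≠ b) :
    tensorPow _ (swapMat a b) * pairSum n * tensorPow _ (swapMat a b) = pairSum n := by
  simp only [pairSum, Finset.mul_sum, Finset.sum_mul]
  refine Finset.sum_congr rfl fun j _ => ?_
  rw [← Equiv.sum_comp (Equiv.swap a b) fun c => pairMat n c j]
  refine Finset.sum_congr rfl fun c _ => ?_
  obtain ⟨ε, hε, h⟩ := swapMat_conj_pauli hab c
  exact tensorPow_conj_pairMat (swapMat_mul_self hab) hε h j

theorem exists_re_im_polynomial (N : ℂ[X]) :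
    ∃ P Q : ℝ[X], ∀ v : ℝ, (N.eval (v : ℂ)).re = P.eval v ∧ (N.eval (v : ℂ)).im = Q.eval v := by
  induction N using Polynomial.induction_on' with
  | add N M hN hM =>
    obtain ⟨P, Q, h⟩ := hN
    obtain ⟨P', Q', h'⟩ := hM
    exact ⟨P + P', Q + Q', fun v => by simp [h, h']⟩
  | monomial k a =>
    refine ⟨monomial k a.re, monomial k a.im, fun v => ?_⟩
    rw [eval_monomial, eval_monomial, eval_monomial, ← Complex.ofReal_pow]
    exact ⟨Complex.re_mul_ofReal _ _, Complex.im_mul_ofReal _ _⟩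

theorem gapMat_smul (n : ℕ) (t : ℂ) (J : Axis → ℂ) :
    gapMat n (fun a => t * J a) = t • gapMat n J := by
  simp only [gapMat, mul_smul, Finset.smul_sum, smul_comm t]

theorem IsSupersymmetric.prod_neg {J : Axis → ℝ} (hJ : IsSupersymmetric J)
    (h0 : ∀ a, J a ≠ 0) : J .x * J .y * J .z < 0 := by
  have h1 := hJ.add_pos (h0 .x)
  have h2 := hJ.1
  have h3 : 0 < (J .x * J .y) ^ 2 := by have := mul_ne_zero (h0 .x) (h0 .y); positivity
  by_contra h
  push Not at h
  have h4 : J .x * J .y * J .z * (J .x + J .y) = -(J .x * J .y) ^ 2 := by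
    linear_combination J .x * J .y * h2
  have h5 := mul_nonneg h h1.le
  linarith

/-- A rescaling of the couplings after which all symmetric functions of them are polynomials in
the normalized discriminant. -/
theorem IsSupersymmetric.exists_normalization {J : Axis → ℝ} (hJ : IsSupersymmetric J)
    (h0 : ∀ a, J a ≠ 0) :
    ∃ t : ℝ, t ≠ 0 ∧ IsSupersymmetric (fun a => t * J a) ∧
      t * (J .x + J .y + J .z) = (normDiscr J + 27) / 4 ∧
      t ^ 3 * (J .x * J .y * J .z) = -((normDiscr J + 27) / 4) ^ 2 := by
  have h3 := hJ.prod_neg h0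
  obtain ⟨h1, h2⟩ := hJ
  have hx := h0 .x
  have hy := h0 .y
  have hz := h0 .z
  -- With $e_1,e_3$ the sum and product of the couplings, the scale is $t=-e_1^2/e_3$. It makes
  -- $te_1=v$ and $t^3e_3=-v^2$ for $v=-e_1^3/e_3$.
  have ht : 0 < -((J .x + J .y + J .z) ^ 2 / (J .x * J .y * J .z)) :=
    neg_pos.mpr (div_neg_of_pos_of_neg (by positivity) h3)
  have hZ : (normDiscr J + 27) / 4 = -((J .x + J .y + J .z) ^ 3 / (J .x * J .y * J .z)) := by
    -- The cubic discriminant with $e_2=0$ is $-4e_1^3e_3-27e_3^2$, which gives $v=(Z+27)/4$.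
    have h4 : (J .x - J .y) ^ 2 * (J .y - J .z) ^ 2 * (J .x - J .z) ^ 2 =
        -4 * (J .x + J .y + J .z) ^ 3 * (J .x * J .y * J .z) -
          27 * (J .x * J .y * J .z) ^ 2 := by
      linear_combination ((J .x + J .y + J .z) ^ 2 * (J .x * J .y + J .x * J .z + J .y * J .z)
        - 4 * (J .x * J .y + J .x * J .z + J .y * J .z) ^ 2
        + 18 * (J .x + J .y + J .z) * (J .x * J .y * J .z)) * h1
    rw [normDiscr, h4]
    field_simp
    ring
  refine ⟨_, ht.ne', ⟨?_, ?_⟩, ?_, ?_⟩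
  · linear_combination (-((J .x + J .y + J .z) ^ 2 / (J .x * J .y * J .z))) ^ 2 * h1
  · have := mul_pos ht h2
    linarith
  · rw [hZ]
    ring
  · rw [hZ]
    field_simp

/-- Rescaling `J` does not change the kernel, so both traces may be evaluated at the normalized
couplings, where they are polynomials in the discriminant. The factor `2 * n + 1` counts the bonds.
-/
theorem exists_sum_correlation {n : ℕ} (hn : 1 ≤ n) :
    ∃ P Q : ℝ[X], ∀ J : Axis → ℝ, IsSupersymmetric J → (∀ a, J a ≠ 0) → ∀ c : Axis → ℝ,
      (∀ Ψ : Config (2 * n + 1) → ℂ, gapMat n (fun a => (J a : ℂ)) *ᵥ Ψ = 0 → ∀ a j,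
        star Ψ ⬝ᵥ (pairMat n a j *ᵥ Ψ) = c a * (star Ψ ⬝ᵥ Ψ)) →
      Q.eval (normDiscr J) ≠ 0 ∧
        P.eval (normDiscr J) = (2 * n + 1 : ℕ) * (∑ a, c a) * Q.eval (normDiscr J) := by
  obtain ⟨N, hN⟩ := exists_symmetric_trace_kerPoly (pairSum n) fun a b h => swap_conj_pairSum n h
  obtain ⟨D, hD⟩ := exists_symmetric_trace_kerPoly (1 : Matrix (Config (2 * n + 1)) _ ℂ)
    fun a b h => by rw [Matrix.mul_one, tensorPow_mul_self (swapMat_mul_self h)]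
  set V : ℂ[X] := Polynomial.C (1 / 4) * (X + Polynomial.C 27) with hV
  have hsub : ∀ (M : MvPolynomial (Fin 3) ℂ) (z : ℝ),
      (MvPolynomial.aeval ![V, 0, -V ^ 2] M).eval (z : ℂ) =
        MvPolynomial.eval ![(((z + 27) / 4 : ℝ) : ℂ), 0, ((-((z + 27) / 4) ^ 2 : ℝ) : ℂ)] M := by
    intro M z
    rw [← Polynomial.coe_evalRingHom, MvPolynomial.map_aeval]
    have h4 : (Polynomial.evalRingHom (z : ℂ)).comp (algebraMap ℂ ℂ[X]) = RingHom.id ℂ := by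
      ext r
      simp
    rw [h4]
    change MvPolynomial.eval _ M = _
    congr 2
    funext i
    fin_cases i
    · simp [hV]
      ring
    · simp
    · simp [hV]
      ring
  obtain ⟨N₁, N₂, hN'⟩ := exists_re_im_polynomial (MvPolynomial.aeval ![V, 0, -V ^ 2] N)
  obtain ⟨D₁, D₂, hD'⟩ := exists_re_im_polynomial (MvPolynomial.aeval ![V, 0, -V ^ 2] D)
  -- The traces are a priori complex polynomials. Multiplying numerator and denominator by the
  -- conjugate of the denominator gives real ones, the new denominator being $|D|^2$.
  refine ⟨N₁ * D₁ + N₂ * D₂, D₁ * D₁ + D₂ * D₂, fun J hJ h0 c hc => ?_⟩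
  obtain ⟨t, ht0, htJ, ht1, ht3⟩ := hJ.exists_normalization h0
  have hG := htJ.isGapped hn fun a => mul_ne_zero ht0 (h0 a)
  obtain ⟨q, hq, hq0⟩ := hG.charpoly
  set A := gapMat n fun a => ((t * J a : ℝ) : ℂ) with hA
  have hker : ∀ v, A *ᵥ v = 0 → gapMat n (fun a => (J a : ℂ)) *ᵥ v = 0 := by
    intro v hv
    simp only [hA, Complex.ofReal_mul] at hv
    rw [gapMat_smul, Matrix.smul_mulVec, smul_eq_zero] at hv
    exact hv.resolve_left (Complex.ofReal_ne_zero.mpr ht0)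
  have hb : ∀ v, A *ᵥ v = 0 → star v ⬝ᵥ (pairSum n *ᵥ v) =
      (((2 * n + 1 : ℕ) * ∑ a, c a : ℝ) : ℂ) * (star v ⬝ᵥ v) := by
    intro v hv
    simp only [pairSum, Matrix.sum_mulVec, dotProduct_sum, hc v (hker v hv), ← Finset.sum_mul,
      Finset.sum_const, Finset.card_univ, Fintype.card_fin, nsmul_eq_mul]
    push_cast
    ring
  obtain ⟨h1, h2⟩ := trace_kerPoly_mul (gapMat_isHermitian n _) (pairSum_isHermitian n) hq hq0 hb
  have hvec : ![((t * J .x : ℝ) : ℂ) + ((t * J .y : ℝ) : ℂ) + ((t * J .z : ℝ) : ℂ),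
      ((t * J .x : ℝ) : ℂ) * ((t * J .y : ℝ) : ℂ) + ((t * J .x : ℝ) : ℂ) * ((t * J .z : ℝ) : ℂ) +
        ((t * J .y : ℝ) : ℂ) * ((t * J .z : ℝ) : ℂ),
      ((t * J .x : ℝ) : ℂ) * ((t * J .y : ℝ) : ℂ) * ((t * J .z : ℝ) : ℂ)] =
      ![(((normDiscr J + 27) / 4 : ℝ) : ℂ), 0, ((-((normDiscr J + 27) / 4) ^ 2 : ℝ) : ℂ)] := by
    rw [← ht3, ← ht1]
    have h5 : t * J .x * (t * J .y) + t * J .x * (t * J .z) + t * J .y * (t * J .z) = 0 := htJ.1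
    have h6 : ((t * J .x : ℝ) : ℂ) * ((t * J .y : ℝ) : ℂ) +
        ((t * J .x : ℝ) : ℂ) * ((t * J .z : ℝ) : ℂ) +
        ((t * J .y : ℝ) : ℂ) * ((t * J .z : ℝ) : ℂ) = 0 := by exact_mod_cast h5
    rw [h6]
    congr 1
    · push_cast
      ring
    · congr 2
      push_cast
      ring
  have hNe := hN fun a => ((t * J a : ℝ) : ℂ)
  have hDe := hD fun a => ((t * J a : ℝ) : ℂ)
  rw [hvec, ← hsub] at hNe hDe
  rw [Matrix.mul_one] at hDe
  rw [← hA] at hNe hDe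
  rw [hNe, hDe] at h1
  rw [hDe] at h2
  obtain ⟨hn1, hn2⟩ := hN' (normDiscr J)
  obtain ⟨hd1, hd2⟩ := hD' (normDiscr J)
  rw [h1, Complex.re_ofReal_mul, hd1] at hn1
  rw [h1, Complex.im_ofReal_mul, hd2] at hn2
  simp only [eval_add, eval_mul, ← hn1, ← hn2]
  refine ⟨fun h => h2 ?_, by ring⟩
  have h7 := (mul_self_add_mul_self_eq_zero).mp h
  exact Complex.ext (hd1.trans h7.1) (hd2.trans h7.2)

/-! ### Assembling the statement -/

/-- The reduced denominator divides `B`, so cancelling common factors creates no pole where `B` is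
nonzero. -/
theorem ratFunc_div_eval {A B : ℝ[X]} {z : ℝ} (hB : B.eval z ≠ 0) :
    ((algebraMap ℝ[X] (RatFunc ℝ) A / algebraMap ℝ[X] (RatFunc ℝ) B).denom.eval z ≠ 0) ∧
      (algebraMap ℝ[X] (RatFunc ℝ) A / algebraMap ℝ[X] (RatFunc ℝ) B).eval (RingHom.id ℝ) z =
        A.eval z / B.eval z := by
  have hB0 : B ≠ 0 := fun h => hB (by rw [h, eval_zero])
  set f := algebraMap ℝ[X] (RatFunc ℝ) A / algebraMap ℝ[X] (RatFunc ℝ) B with hf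
  have h1 : f.denom.eval z ≠ 0 := by
    obtain ⟨r, hr⟩ := RatFunc.denom_div_dvd A B
    intro h
    apply hB
    rw [hr, eval_mul, h, zero_mul]
  refine ⟨h1, ?_⟩
  have h2 := congrArg (Polynomial.eval z) ((RatFunc.num_mul_eq_mul_denom_iff hB0).mpr hf)
  rw [eval_mul, eval_mul] at h2
  rw [RatFunc.eval]
  change f.num.eval z / f.denom.eval z = _
  rw [div_eq_div_iff h1 hB, h2]

theorem pairOp_apply (n : ℕ) (a : Axis) (j : Fin (2 * n + 1)) (Ψ : StateSpace (2 * n + 1)) :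
    (pairOp n a j Ψ).ofLp = pairMat n a j *ᵥ Ψ.ofLp := rfl

theorem hamiltonian_apply (n : ℕ) (J : Axis → ℝ) (Ψ : StateSpace (2 * n + 1)) :
    (hamiltonian n J Ψ).ofLp = gapMat n (fun a => (J a : ℂ)) *ᵥ Ψ.ofLp -
      (((2 * n + 1 : ℕ) * (J .x + J .y + J .z) / 2 : ℝ) : ℂ) • Ψ.ofLp := by
  simp only [hamiltonian, gapMat, sum_axis, LinearMap.smul_apply, LinearMap.sum_apply,
    LinearMap.add_apply, Matrix.smul_mulVec, Matrix.sum_mulVec,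
    Matrix.add_mulVec, Matrix.sub_mulVec, Matrix.one_mulVec, WithLp.ofLp_smul, WithLp.ofLp_sum,
    WithLp.ofLp_add, pairOp_apply, smul_sub, Finset.sum_add_distrib, Finset.sum_sub_distrib,
    Finset.sum_const, Finset.card_univ, Fintype.card_fin, smul_add]
  push_cast
  module

/-- A zero mode bounds the lowest energy from above by $-L(J_x+J_y+J_z)/2$, and positivity bounds it
from below. -/
theorem IsGroundState.gapMat_mulVec_eq_zero {n : ℕ} {J : Axis → ℝ} {Ψ : StateSpace (2 * n + 1)}
    (h : IsGroundState n J Ψ) (hG : IsGapped n J) :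
    gapMat n (fun a => (J a : ℂ)) *ᵥ Ψ.ofLp = 0 := by
  obtain ⟨E, hE, hmin⟩ := h
  set e := (2 * n + 1 : ℕ) * (J .x + J .y + J .z) / 2 with he
  have hle : E ≤ -e := by
    obtain ⟨Φ, hΦ0, hΦ⟩ := hG.exists_ne_zero
    refine hmin _ (Module.End.hasEigenvalue_of_hasEigenvector (x := WithLp.toLp 2 Φ) ⟨?_, ?_⟩)
    · rw [Module.End.mem_eigenspace_iff]
      apply WithLp.ofLp_injective
      rw [hamiltonian_apply, ← he, hΦ]
      simp
    · intro h0
      exact hΦ0 (congrArg WithLp.ofLp h0)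
  have h1 := congrArg WithLp.ofLp hE.apply_eq_smul
  rw [hamiltonian_apply, ← he, WithLp.ofLp_smul, sub_eq_iff_eq_add, ← add_smul,
    ← Complex.ofReal_add] at h1
  have hΨ0 : Ψ.ofLp ≠ 0 := fun h => hE.2 (WithLp.ofLp_injective 2 h)
  have hpos : 0 < star Ψ.ofLp ⬝ᵥ Ψ.ofLp := dotProduct_star_self_pos_iff.mpr hΨ0
  have h2 := hG.posSemidef.dotProduct_mulVec_nonneg Ψ.ofLp
  rw [h1, dotProduct_smul, smul_eq_mul] at h2
  have h3 : (0 : ℂ) ≤ ((E + e : ℝ) : ℂ) := le_of_mul_le_mul_right (by simpa using h2) hpos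
  have h4 : E + e = 0 := le_antisymm (by linarith) (by exact_mod_cast h3)
  rw [h1, h4, Complex.ofReal_zero, zero_smul]

theorem expectation_eq {n : ℕ} {a : Axis} {j : Fin (2 * n + 1)} {Ψ : StateSpace (2 * n + 1)}
    (hΨ : Ψ ≠ 0) {c : ℂ}
    (h : star Ψ.ofLp ⬝ᵥ (pairMat n a j *ᵥ Ψ.ofLp) = c * (star Ψ.ofLp ⬝ᵥ Ψ.ofLp)) :
    expectation Ψ (pairOp n a j) = c := by
  have hΨ0 : Ψ.ofLp ≠ 0 := fun h => hΨ (WithLp.ofLp_injective 2 h)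
  have hpos : 0 < star Ψ.ofLp ⬝ᵥ Ψ.ofLp := dotProduct_star_self_pos_iff.mpr hΨ0
  rw [expectation, EuclideanSpace.inner_eq_star_dotProduct,
    EuclideanSpace.inner_eq_star_dotProduct, pairOp_apply, dotProduct_comm, h,
    dotProduct_comm Ψ.ofLp, mul_div_cancel_right₀ _ hpos.ne']

theorem pairMat_zero (a : Axis) (j : Fin (2 * 0 + 1)) : pairMat 0 a j = 1 := by
  have : Subsingleton (Fin (2 * 0 + 1)) := inferInstanceAs (Subsingleton (Fin 1))
  have h : j + 1 = j := Subsingleton.elim _ _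
  rw [pairMat, h, siteMatrix_eq_prodMat, prodMat_mul, ← prodMat_one]
  congr 1
  funext k
  rw [Subsingleton.elim k j]
  simp [pauli_mul_self]

end XYZChain

theorem proposition2p1 (n : ℕ) :
    ∃ f : RatFunc ℝ, ∀ J : XYZChain.Axis → ℝ, XYZChain.IsSupersymmetric J → (∀ a, J a ≠ 0) →
      f.denom.eval (XYZChain.normDiscr J) ≠ 0 ∧
      ∀ Ψ : XYZChain.StateSpace (2 * n + 1), XYZChain.IsGroundState n J Ψ →
        ∀ (a : XYZChain.Axis) (j : Fin (2 * n + 1)),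
          XYZChain.expectation Ψ (XYZChain.pairOp n a j) =
            ((1 + J .x * J .y * J .z / (J a ^ 2 * (J .x + J .y + J .z)) *
              f.eval (RingHom.id ℝ) (XYZChain.normDiscr J) : ℝ) : ℂ) := by
  rcases Nat.eq_zero_or_pos n with rfl | hn
  -- With a single site each pair operator is a squared Pauli matrix, so every correlation is 1.
  · refine ⟨0, fun J _ _ => ⟨by simp, fun Ψ hΨ a j => ?_⟩⟩
    obtain ⟨E, hE, -⟩ := hΨ
    refine XYZChain.expectation_eq hE.2 ?_
    rw [XYZChain.pairMat_zero, Matrix.one_mulVec, RatFunc.eval_zero]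
    simp
  · obtain ⟨P, Q, hPQ⟩ := XYZChain.exists_sum_correlation hn
    set l : ℝ := ((2 * n + 1 : ℕ) : ℝ) with hl
    have hl0 : l ≠ 0 := by positivity
    -- The function is $(3-\sum_a C^a)/2$, where $\sum_a C^a=P/(lQ)$.
    refine ⟨algebraMap _ (RatFunc ℝ) (Polynomial.C (3 * l) * Q - P) /
      algebraMap _ (RatFunc ℝ) (Polynomial.C (2 * l) * Q), fun J hJ h0 => ?_⟩
    have hG := hJ.isGapped hn h0
    obtain ⟨c, hc⟩ := hG.correlation
    obtain ⟨hQ, hP⟩ := hPQ J hJ h0 c hc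
    have hB : (Polynomial.C (2 * l) * Q).eval (XYZChain.normDiscr J) ≠ 0 := by
      rw [Polynomial.eval_mul, Polynomial.eval_C]
      exact mul_ne_zero (mul_ne_zero two_ne_zero hl0) hQ
    obtain ⟨h1, h2⟩ := XYZChain.ratFunc_div_eval (A := Polynomial.C (3 * l) * Q - P) hB
    refine ⟨h1, fun Ψ hΨ a j => ?_⟩
    have hker := hΨ.gapMat_mulVec_eq_zero hG
    have hκ : (3 - ∑ b, c b) / 2 =
        (Polynomial.C (3 * l) * Q - P).eval (XYZChain.normDiscr J) /
          (Polynomial.C (2 * l) * Q).eval (XYZChain.normDiscr J) := by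
      simp only [Polynomial.eval_sub, Polynomial.eval_mul, Polynomial.eval_C, hP]
      field_simp
    obtain ⟨E, hE, -⟩ := hΨ
    rw [h2, ← hκ, ← XYZChain.correlation_eq hn hJ h0 hc a]
    exact XYZChain.expectation_eq hE.2 (hc _ hker a j)
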